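/- Let $m\ge 0$ be an integer, $2<p\le\infty$, let $\Omega\subset\mathbb C$ be a connected open set, and let $f:\Omega\to\mathbb C^m$ be continuous. Put $\Omega^*=\Omega\setminus f^{-1}(0)$, and let $A=(a_{jk})$ be an $m\times m$ matrix of functions $a_{jk}\in L^p(\Omega^*)$ such that $$\frac{\partial f}{\partial\bar z}=Af\quad\text{on }\Omega^*$$ in the sense of distributions. (The matrix of $(0,1)$-forms $A\,d\bar z$ is identified with the matrix $A$ of its coefficients, so that this is the equation $\bar\partial f=Af$.) Let $\tilde A$ be equal to $A$ on $\Omega^*$ and to $0$ on $f^{-1}(0)$. (1) If $f\not\equiv0$ on $\Omega$, then the zeros of $f$ in $\Omega$ are isolated, and $\partial f/\partial\bar z=\tilde Af$ holds on $\Omega$ in the sense of distributions. (2) Put $\phi_p(\delta)=\delta^{1-2/p}$ if $p<\infty$ and $\phi_\infty(\delta)=\delta(1+|\log\delta|)$. There are constants $\epsilon>0$ and $c>0$, depending only on $p$ and $m$, such that the following holds for all $\Omega,f,A$ as above (including $f\equiv0$) and all $M\in[0,\infty)$ with $\|a_{jk}\|_{L^p(\Omega^*)}\le M$ for all $j,k$.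 First, $\partial f/\partial\bar z=\tilde Af$ on $\Omega$ in the sense of distributions. Second, if $\delta>0$ and $M\phi_p(\delta)<\epsilon$, then for each $z\in\Omega$ there is an $m\times m$ matrix-valued function $g$ on the disc $D_\delta(z)=\{w\in\mathbb C:|w-z|<\delta\}$ such that - $I+g(w)$ is invertible for every $w\in D_\delta(z)$; - $(I+g)f$ is holomorphic on $D_\delta(z)\cap\Omega$; - $g\in C^\alpha(D_\delta(z))$, i.e. the entries of $g$ are Hölder continuous with exponent $\alpha$ on $D_\delta(z)$, with $\alpha=1-\frac2p$ if $p<\infty$, and for every $\alpha\in(0,1)$ if $p=\infty$; - $\sup_{w\in D_\delta(z)}|g_{jk}(w)|\le c\,M\,\phi_p(\delta)$ for all $j,k$. -/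

import Mathlib

open MeasureTheory Set Filter Topology
open scoped ENNReal NNReal ContDiff Matrix

noncomputable section

/-- The Wirtinger derivative `∂φ/∂z̄ = (∂φ/∂x + i ∂φ/∂y) / 2`. -/
def dzbar (φ : ℂ → ℂ) (z : ℂ) : ℂ :=
  (1 / 2) * (fderiv ℝ φ z 1 + Complex.I * fderiv ℝ φ z Complex.I)

/-- `∂u/∂z̄ = h` on the open set `U` in the sense of distributions, for locally integrable
`ℂ^m`-valued functions `u` and `h`, tested against complex-valued smooth functions with compact
support in `U`. -/
def DbarEqOn {m : ℕ} (u h : ℂ → Fin m → ℂ) (U : Set ℂ) : Prop :=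
  LocallyIntegrableOn u U ∧ LocallyIntegrableOn h U ∧
    ∀ φ : ℂ → ℂ, ContDiff ℝ ∞ φ → HasCompactSupport φ → tsupport φ ⊆ U →
      ∀ j : Fin m, ∫ z in U, u z j * dzbar φ z = -∫ z in U, h z j * φ z

/-- The part of `Ω` off the zero set of `f`. -/
def offZeros {m : ℕ} (Ω : Set ℂ) (f : ℂ → Fin m → ℂ) : Set ℂ :=
  {z ∈ Ω | f z ≠ 0}

/-- `φ_p(δ) = δ^(1 - 2/p)` for `p < ∞` and `φ_∞(δ) = δ (1 + |log δ|)`. -/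
def phi (p : ℝ≥0∞) (δ : ℝ) : ℝ :=
  if p = ⊤ then δ * (1 + |Real.log δ|) else δ ^ (1 - 2 / p.toReal)

/-- Every entry of `g` is Hölder continuous with exponent `α` on `U`. -/
def MatrixHolderOn {m : ℕ} (α : ℝ≥0) (g : ℂ → Matrix (Fin m) (Fin m) ℂ) (U : Set ℂ) : Prop :=
  ∀ j k, ∃ C : ℝ≥0, HolderOnWith C α (fun w => g w j k) U

end

/-!
Near each point, a frame `G = 1 + g` with `∂G/∂z̄ = -G A` turns `∂f/∂z̄ = A f` into
`∂(G f)/∂z̄ = 0`. Written with the Cauchy transform `T`, the equation for `G` is the fixed point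
problem `g = -T ((1 + g) A)`; on a disc of radius `δ` Hölder's inequality bounds the norm of
`g ↦ T (g A)` by a multiple of `‖A‖_p δ^(1 - 2/p)`, so it is a contraction once this is small. Off
the zeros of `f` the function `G f` is then holomorphic by Weyl's lemma, and it is holomorphic
across them by Radó's theorem, since it is continuous and vanishes only there. Hence the zeros of
`f` are those of a holomorphic function, so that locally they are isolated or fill a neighbourhood;
the weak equation extends trivially across the latter, and across the former because a point is
removable for a continuous solution.
-/

section Dzbar

variable {φ ψ : ℂ → ℂ} {z : ℂ}

lemma dzbar_congr (h : φ =ᶠ[𝓝 z] ψ) : dzbar φ z = dzbar ψ z := by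
  rw [dzbar, dzbar, h.fderiv_eq]

lemma dzbar_const (c : ℂ) : dzbar (fun _ => c) z = 0 := by
  simp [dzbar]

lemma dzbar_sum {ι : Type*} {s : Finset ι} {φ : ι → ℂ → ℂ}
    (hφ : ∀ i ∈ s, DifferentiableAt ℝ (φ i) z) :
    dzbar (fun w => ∑ i ∈ s, φ i w) z = ∑ i ∈ s, dzbar (φ i) z := by
  simp only [dzbar, fderiv_fun_sum hφ, sum_apply, Finset.mul_sum,
    ← Finset.sum_add_distrib]

lemma dzbar_mul (hφ : DifferentiableAt ℝ φ z) (hψ : DifferentiableAt ℝ ψ z) :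
    dzbar (fun w => φ w * ψ w) z = dzbar φ z * ψ z + φ z * dzbar ψ z := by
  simp only [dzbar, fderiv_fun_mul hφ hψ, add_apply, smul_apply, smul_eq_mul]
  ring

lemma dzbar_eq_zero_of_differentiableAt (hφ : DifferentiableAt ℂ φ z) : dzbar φ z = 0 := by
  have h := (differentiableAt_complex_iff_differentiableAt_real.1 hφ).2
  rw [dzbar, h, smul_eq_mul, ← mul_assoc, Complex.I_mul_I]
  ring

lemma differentiableAt_of_dzbar_eq_zero (hφ : DifferentiableAt ℝ φ z) (h : dzbar φ z = 0) :
    DifferentiableAt ℂ φ z := by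
  refine differentiableAt_complex_iff_differentiableAt_real.2 ⟨hφ, ?_⟩
  rw [dzbar] at h
  rw [smul_eq_mul]
  linear_combination -2 * Complex.I * h + fderiv ℝ φ z Complex.I * Complex.I_sq

open ComplexConjugate in
lemma dzbar_conj (hφ : DifferentiableAt ℂ φ z) :
    dzbar (fun w => conj (φ w)) z = conj (deriv φ z) := by
  have h : fderiv ℝ (fun w => conj (φ w)) z = _ :=
    (Complex.conjCLE.hasFDerivAt.comp z
      (hφ.hasDerivAt.hasFDerivAt.restrictScalars ℝ)).fderiv
  have h1 : fderiv ℝ (fun w => conj (φ w)) z 1 = conj (deriv φ z) := by simp [h]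
  have hI : fderiv ℝ (fun w => conj (φ w)) z Complex.I = -Complex.I * conj (deriv φ z) := by
    simp [h]
  rw [dzbar, h1, hI]
  linear_combination -(1 / 2) * conj (deriv φ z) * Complex.I_sq

open ComplexConjugate in
lemma dzbar_conj_mul (hφ : DifferentiableAt ℂ φ z) (hψ : DifferentiableAt ℂ ψ z) :
    dzbar (fun w => conj (φ w) * ψ w) z = conj (deriv φ z) * ψ z := by
  have hφ' : DifferentiableAt ℝ φ z := hφ.restrictScalars ℝ
  rw [dzbar_mul (by fun_prop) (hψ.restrictScalars ℝ), dzbar_conj hφ,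
    dzbar_eq_zero_of_differentiableAt hψ, mul_zero, add_zero]

lemma dzbar_ofReal_comp {η : ℝ → ℝ} {s : ℂ → ℝ} (hη : DifferentiableAt ℝ η (s z))
    (hs : DifferentiableAt ℝ s z) :
    dzbar (fun w => (η (s w) : ℂ)) z = deriv η (s z) * dzbar (fun w => (s w : ℂ)) z := by
  have h := Complex.ofRealCLM.hasFDerivAt.comp z (hη.hasDerivAt.comp_hasFDerivAt z hs.hasFDerivAt)
  have h' : fderiv ℝ (fun w => (η (s w) : ℂ)) z = _ := h.fderiv
  have k := Complex.ofRealCLM.hasFDerivAt.comp z hs.hasFDerivAt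
  have k' : fderiv ℝ (fun w => (s w : ℂ)) z = _ := k.fderiv
  rw [dzbar, dzbar, h', k']
  simp only [ContinuousLinearMap.comp_smulₛₗ, Real.ringHom_apply, smul_apply,
    ContinuousLinearMap.comp_apply, Complex.ofRealCLM_apply, Complex.real_smul]
  ring

open ComplexConjugate in
lemma dzbar_ofReal_comp_normSq {η : ℝ → ℝ} (hη : Differentiable ℝ η)
    (hφ : DifferentiableAt ℂ φ z) :
    dzbar (fun w => (η (Complex.normSq (φ w)) : ℂ)) z =
      deriv η (Complex.normSq (φ z)) * (φ z * conj (deriv φ z)) := by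
  have hφ' : DifferentiableAt ℝ φ z := hφ.restrictScalars ℝ
  have hs : DifferentiableAt ℝ (fun w => Complex.normSq (φ w)) z := by
    simp only [Complex.normSq_apply]
    fun_prop
  rw [dzbar_ofReal_comp (s := fun w => Complex.normSq (φ w)) (hη _) hs]
  simp only [← Complex.mul_conj]
  rw [dzbar_mul hφ' (by fun_prop), dzbar_conj hφ, dzbar_eq_zero_of_differentiableAt hφ]
  ring

lemma dzbar_comp_const_sub (x t : ℂ) (φ : ℂ → ℂ) :
    dzbar (fun s => φ (x - s)) t = -dzbar φ (x - t) := by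
  have h : fderiv ℝ (fun s => φ (x - s)) t = -fderiv ℝ φ (x - t) := by
    have := fderiv_comp_smul (𝕜 := ℝ) (f := fun y => φ (x + y)) (x := t) (-1 : ℝ)
    simpa only [neg_smul, one_smul, fderiv_comp_add_left, ← sub_eq_add_neg] using this
  simp only [dzbar, h, neg_apply]
  ring

lemma continuous_dzbar (hφ : ContDiff ℝ 1 φ) : Continuous (dzbar φ) := by
  have := hφ.continuous_fderiv one_ne_zero
  unfold dzbar
  fun_prop

lemma tsupport_dzbar_subset (φ : ℂ → ℂ) : tsupport (dzbar φ) ⊆ tsupport φ := by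
  refine closure_minimal (fun z hz => support_fderiv_subset ℝ fun h => hz ?_) (isClosed_tsupport _)
  simp [dzbar, h]

lemma hasCompactSupport_dzbar (hφ : HasCompactSupport φ) : HasCompactSupport (dzbar φ) :=
  hφ.of_isClosed_subset (isClosed_tsupport _) (tsupport_dzbar_subset φ)

lemma integrable_dzbar (hφ : ContDiff ℝ 1 φ) (hφc : HasCompactSupport φ) :
    Integrable (dzbar φ) :=
  (continuous_dzbar hφ).integrable_of_hasCompactSupport (hasCompactSupport_dzbar hφc)

lemma integral_dzbar_eq_zero (hφ : ContDiff ℝ 1 φ) (hφc : HasCompactSupport φ) :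
    ∫ z, dzbar φ z = 0 := by
  have hi : ∀ v, Integrable fun z => fderiv ℝ φ z v := fun v =>
    ((hφ.continuous_fderiv one_ne_zero).clm_apply continuous_const).integrable_of_hasCompactSupport
      (hφc.fderiv_apply ℝ v)
  have h0 : ∀ v, ∫ z, fderiv ℝ φ z v = 0 := fun v => by
    have := integral_mul_fderiv_eq_neg_fderiv_mul_of_integrable (μ := volume)
      (f := fun _ => (1 : ℂ)) (g := φ) (v := v) (by simp) (by simpa using hi v)
      (by simpa using hφ.continuous.integrable_of_hasCompactSupport hφc) (by fun_prop)
      fun z _ => hφ.differentiable one_ne_zero z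
    simpa using this
  simp only [dzbar]
  rw [integral_const_mul, integral_add (hi 1) ((hi _).const_mul _), integral_const_mul, h0, h0]
  simp

end Dzbar

/-- `φ` is a test function on `U`: smooth, complex valued, with compact support in `U`. -/
structure IsTestFunction (φ : ℂ → ℂ) (U : Set ℂ) : Prop where
  contDiff : ContDiff ℝ ∞ φ
  hasCompactSupport : HasCompactSupport φ
  tsupport_subset : tsupport φ ⊆ U

lemma integrable_mul_of_tsupport_subset {U : Set ℂ} {u φ : ℂ → ℂ} (hu : LocallyIntegrableOn u U)
    (hφ : Continuous φ) (hφc : HasCompactSupport φ) (hφU : tsupport φ ⊆ U) :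
    Integrable fun z => u z * φ z := by
  have h : IntegrableOn (fun z => u z * φ z) (tsupport φ) :=
    (hu.integrableOn_compact_subset hφU hφc).mul_continuousOn hφ.continuousOn hφc
  exact h.integrable_of_forall_notMem_eq_zero fun z hz => by
    rw [image_eq_zero_of_notMem_tsupport hz, mul_zero]

lemma locallyIntegrableOn_finsetSum {ι : Type*} {s : Finset ι} {u : ι → ℂ → ℂ} {U : Set ℂ}
    (hu : ∀ i ∈ s, LocallyIntegrableOn (u i) U) :
    LocallyIntegrableOn (fun z => ∑ i ∈ s, u i z) U := by
  rw [← Finset.sum_fn]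
  exact Finset.sum_induction u (LocallyIntegrableOn · U) (fun _ _ => LocallyIntegrableOn.add)
    (locallyIntegrable_zero.locallyIntegrableOn U) hu

namespace IsTestFunction

variable {φ ψ u : ℂ → ℂ} {U V : Set ℂ}

lemma ofReal {ρ : ℂ → ℝ} (hρ : ContDiff ℝ ∞ ρ) (hρc : HasCompactSupport ρ) (hρU : tsupport ρ ⊆ U) :
    IsTestFunction (fun z => (ρ z : ℂ)) U :=
  ⟨Complex.ofRealCLM.contDiff.comp hρ, hρc.comp_left Complex.ofReal_zero,
    (closure_mono (Function.support_comp_subset Complex.ofReal_zero _)).trans hρU⟩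

lemma mono (hφ : IsTestFunction φ U) (hUV : U ⊆ V) : IsTestFunction φ V :=
  ⟨hφ.contDiff, hφ.hasCompactSupport, hφ.tsupport_subset.trans hUV⟩

lemma mul_right (hφ : IsTestFunction φ U) (hψ : ContDiff ℝ ∞ ψ) :
    IsTestFunction (fun z => φ z * ψ z) U :=
  ⟨hφ.contDiff.mul hψ, hφ.hasCompactSupport.mul_right,
    (tsupport_mul_subset_left (f := φ) (g := ψ)).trans hφ.tsupport_subset⟩

lemma differentiable (hφ : IsTestFunction φ U) : Differentiable ℝ φ :=
  hφ.contDiff.differentiable (by simp)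

lemma continuous_dzbar (hφ : IsTestFunction φ U) : Continuous (dzbar φ) :=
  _root_.continuous_dzbar (hφ.contDiff.of_le (by simp))

lemma dzbar_eq_zero (hφ : IsTestFunction φ U) {z : ℂ} (hz : z ∉ U) : dzbar φ z = 0 :=
  image_eq_zero_of_notMem_tsupport fun h => hz (hφ.tsupport_subset (tsupport_dzbar_subset φ h))

lemma eq_zero (hφ : IsTestFunction φ U) {z : ℂ} (hz : z ∉ U) : φ z = 0 :=
  image_eq_zero_of_notMem_tsupport fun h => hz (hφ.tsupport_subset h)

lemma integrable_mul (hφ : IsTestFunction φ U) (hu : LocallyIntegrableOn u U) :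
    Integrable fun z => u z * φ z :=
  integrable_mul_of_tsupport_subset hu hφ.contDiff.continuous hφ.hasCompactSupport
    hφ.tsupport_subset

lemma integrable_mul_dzbar (hφ : IsTestFunction φ U) (hu : LocallyIntegrableOn u U) :
    Integrable fun z => u z * dzbar φ z :=
  integrable_mul_of_tsupport_subset hu hφ.continuous_dzbar
    (hasCompactSupport_dzbar hφ.hasCompactSupport)
    ((tsupport_dzbar_subset φ).trans hφ.tsupport_subset)

lemma comp_const_sub (hφ : IsTestFunction φ U) (z : ℂ) :
    IsTestFunction (fun w => φ (z - w)) ((fun w => z - w) ⁻¹' U) :=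
  ⟨hφ.contDiff.comp (contDiff_const.sub contDiff_id),
    hφ.hasCompactSupport.comp_homeomorph (Homeomorph.subLeft z),
    (tsupport_comp_subset_preimage φ (by fun_prop)).trans (preimage_mono hφ.tsupport_subset)⟩

end IsTestFunction

/-- The scalar equation `∂u/∂z̄ = h` on `U` in the sense of distributions. Both sides are put under
one integral over the plane, which test functions on `U` restrict to `U`. -/
structure WeakDbarOn (u h : ℂ → ℂ) (U : Set ℂ) : Prop where
  locallyIntegrableOn_left : LocallyIntegrableOn u U
  locallyIntegrableOn_right : LocallyIntegrableOn h U
  integral_eq_zero : ∀ φ, IsTestFunction φ U → ∫ z, (u z * dzbar φ z + h z * φ z) = 0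

namespace WeakDbarOn

variable {u h u' h' : ℂ → ℂ} {U V : Set ℂ}

lemma integrable (H : WeakDbarOn u h U) {φ : ℂ → ℂ} (hφ : IsTestFunction φ U) :
    Integrable fun z => u z * dzbar φ z + h z * φ z :=
  (hφ.integrable_mul_dzbar H.locallyIntegrableOn_left).add
    (hφ.integrable_mul H.locallyIntegrableOn_right)

lemma mono (H : WeakDbarOn u h U) (hVU : V ⊆ U) : WeakDbarOn u h V :=
  ⟨H.locallyIntegrableOn_left.mono_set hVU, H.locallyIntegrableOn_right.mono_set hVU,
    fun φ hφ => H.integral_eq_zero φ (hφ.mono hVU)⟩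

lemma congr (H : WeakDbarOn u h U) (hU : MeasurableSet U) (hu : EqOn u u' U) (hh : EqOn h h' U) :
    WeakDbarOn u' h' U := by
  refine ⟨H.locallyIntegrableOn_left.congr (ae_restrict_of_forall_mem hU hu),
    H.locallyIntegrableOn_right.congr (ae_restrict_of_forall_mem hU hh), fun φ hφ => ?_⟩
  rw [← H.integral_eq_zero φ hφ]
  refine integral_congr_ae (ae_of_all _ fun z => ?_)
  by_cases hz : z ∈ U
  · simp only [hu hz, hh hz]
  · simp only [hφ.eq_zero hz, hφ.dzbar_eq_zero hz, mul_zero]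

lemma zero (U : Set ℂ) : WeakDbarOn 0 0 U :=
  ⟨locallyIntegrableOn_zero, locallyIntegrableOn_zero, fun φ _ => by simp⟩

lemma add (H : WeakDbarOn u h U) (H' : WeakDbarOn u' h' U) :
    WeakDbarOn (fun z => u z + u' z) (fun z => h z + h' z) U := by
  refine ⟨H.locallyIntegrableOn_left.add H'.locallyIntegrableOn_left,
    H.locallyIntegrableOn_right.add H'.locallyIntegrableOn_right, fun φ hφ => ?_⟩
  have hadd := integral_add (H.integrable hφ) (H'.integrable hφ)
  rw [H.integral_eq_zero φ hφ, H'.integral_eq_zero φ hφ, add_zero] at hadd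
  rw [← hadd]
  congr 1 with z
  ring

lemma sum {ι : Type*} {s : Finset ι} {u h : ι → ℂ → ℂ} (H : ∀ i ∈ s, WeakDbarOn (u i) (h i) U) :
    WeakDbarOn (fun z => ∑ i ∈ s, u i z) (fun z => ∑ i ∈ s, h i z) U := by
  refine ⟨locallyIntegrableOn_finsetSum fun i hi => (H i hi).locallyIntegrableOn_left,
    locallyIntegrableOn_finsetSum fun i hi => (H i hi).locallyIntegrableOn_right,
    fun φ hφ => ?_⟩
  simp only [Finset.sum_mul, ← Finset.sum_add_distrib]
  rw [integral_finsetSum s fun i hi => (H i hi).integrable hφ]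
  exact Finset.sum_eq_zero fun i hi => (H i hi).integral_eq_zero φ hφ

end WeakDbarOn

section Weyl

lemma dzbar_convolution {k b : ℂ → ℂ} (hk : LocallyIntegrable k) (hb : ContDiff ℝ 1 b)
    (hbc : HasCompactSupport b) (x : ℂ) :
    dzbar (fun x => ∫ t, k t * b (x - t)) x = ∫ t, k t * dzbar b (x - t) := by
  have hfd : fderiv ℝ (fun x => ∫ t, k t * b (x - t)) x = _ :=
    (hbc.hasFDerivAt_convolution_right (ContinuousLinearMap.mul ℝ ℂ) hk hb x).fderiv
  have hex := (hbc.fderiv ℝ).convolutionExists_right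
    ((ContinuousLinearMap.mul ℝ ℂ).precompR ℂ) hk (hb.continuous_fderiv one_ne_zero) x
  have happ : ∀ v : ℂ, fderiv ℝ (fun x => ∫ t, k t * b (x - t)) x v =
      ∫ t, k t * fderiv ℝ b (x - t) v := fun v => by
    rw [hfd, convolution_def, ContinuousLinearMap.integral_apply hex]
    rfl
  have hint : ∀ v : ℂ, Integrable fun t => k t * fderiv ℝ b (x - t) v := fun v =>
    (hbc.fderiv_apply ℝ v).convolutionExists_right (ContinuousLinearMap.mul ℝ ℂ) hk
      ((hb.continuous_fderiv one_ne_zero).clm_apply continuous_const) x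
  rw [dzbar, happ, happ, ← integral_const_mul, ← integral_add (hint 1) ((hint _).const_mul _),
    ← integral_const_mul]
  congr 1 with t
  rw [dzbar]
  ring

variable {u : ℂ → ℂ} {U : Set ℂ}

lemma WeakDbarOn.differentiableAt_convolution (H : WeakDbarOn u 0 U) {k b : ℂ → ℂ}
    (hk : LocallyIntegrable k) {W : Set ℂ} (hb : IsTestFunction b W) {x : ℂ}
    (hW : (fun w => x - w) ⁻¹' W ⊆ U) (hku : EqOn k u ((fun w => x - w) ⁻¹' W)) :
    DifferentiableAt ℂ (fun x => ∫ t, k t * b (x - t)) x := by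
  have hsmooth : ContDiff ℝ ∞ fun x => ∫ t, k t * b (x - t) :=
    hb.hasCompactSupport.contDiff_convolution_right (ContinuousLinearMap.mul ℝ ℂ) hk hb.contDiff
  refine differentiableAt_of_dzbar_eq_zero (hsmooth.differentiable (by simp) x) ?_
  have hφ := hb.comp_const_sub x
  calc dzbar (fun x => ∫ t, k t * b (x - t)) x
      = ∫ t, k t * dzbar b (x - t) :=
        dzbar_convolution hk (hb.contDiff.of_le (by simp)) hb.hasCompactSupport x
    _ = ∫ t, -(u t * dzbar (fun s => b (x - s)) t + (0 : ℂ → ℂ) t * b (x - t)) := by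
        congr 1 with t
        rw [Pi.zero_apply, zero_mul, add_zero]
        by_cases ht : t ∈ (fun w => x - w) ⁻¹' W
        · rw [dzbar_comp_const_sub, hku ht]
          ring
        · rw [hφ.dzbar_eq_zero ht, hb.dzbar_eq_zero ht]
          ring
    _ = 0 := by rw [integral_neg, H.integral_eq_zero _ (hφ.mono hW), neg_zero]

lemma WeakDbarOn.exists_differentiableOn_dist_le (H : WeakDbarOn u 0 U) (hu : ContinuousOn u U)
    {z₀ : ℂ} {R ε : ℝ} (hR : 0 < R) (hRU : Metric.closedBall z₀ R ⊆ U) (hε : 0 < ε) :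
    ∃ G : ℂ → ℂ, DifferentiableOn ℂ G (Metric.ball z₀ (R / 2)) ∧
      ∀ x ∈ Metric.ball z₀ (R / 2), dist (u x) (G x) ≤ ε := by
  have hK := isCompact_closedBall z₀ R
  set k : ℂ → ℂ := (Metric.closedBall z₀ R).indicator u
  have hku : EqOn k u (Metric.closedBall z₀ R) := fun z hz => indicator_of_mem hz u
  have hkint : Integrable k := (integrable_indicator_iff hK.measurableSet).2
    ((hu.mono hRU).integrableOn_compact hK)
  obtain ⟨δ, hδ, hδu⟩ := Metric.uniformContinuousOn_iff.1
    (hK.uniformContinuousOn_of_continuous (hu.mono hRU)) ε hε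
  let ρ : ContDiffBump (0 : ℂ) :=
    ⟨min δ (R / 2) / 2, min δ (R / 2), by positivity, half_lt_self (by positivity)⟩
  have hb : IsTestFunction (fun w => (ρ.normed volume w : ℂ)) (Metric.closedBall 0 (R / 2)) :=
    .ofReal ρ.contDiff_normed ρ.hasCompactSupport_normed
      ((ρ.tsupport_normed_eq (μ := volume)).subset.trans
        (Metric.closedBall_subset_closedBall (min_le_right _ _)))
  have hball : ∀ x ∈ Metric.ball z₀ (R / 2), (fun w => x - w) ⁻¹' Metric.closedBall 0 (R / 2) ⊆
      Metric.closedBall z₀ R := fun x hx w hw => by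
    rw [mem_preimage, mem_closedBall_zero_iff, ← dist_eq_norm, dist_comm] at hw
    exact (dist_triangle w x z₀).trans (by linarith [Metric.mem_ball.1 hx])
  refine ⟨fun x => ∫ t, k t * (ρ.normed volume (x - t) : ℂ), fun x hx => ?_, fun x hx => ?_⟩
  · exact (H.differentiableAt_convolution hkint.locallyIntegrable hb ((hball x hx).trans hRU)
      (hku.mono (hball x hx))).differentiableWithinAt
  · have hconv : ∫ t, k t * (ρ.normed volume (x - t) : ℂ) =
        convolution (ρ.normed volume) k (ContinuousLinearMap.lsmul ℝ ℝ) volume x := by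
      rw [convolution_eq_swap]
      simp [mul_comm]
    have hx' : x ∈ Metric.closedBall z₀ R := hball x hx (by simpa using (half_pos hR).le)
    beta_reduce
    rw [hconv, dist_comm, ← hku hx']
    refine ρ.dist_normed_convolution_le hkint.aestronglyMeasurable fun y hy => ?_
    have hyx : dist y x < min δ (R / 2) := hy
    have hy' : y ∈ Metric.closedBall z₀ R := hball x hx (by
      simpa [← dist_eq_norm, dist_comm] using (hyx.trans_le (min_le_right _ _)).le)
    rw [hku hx', hku hy']
    exact (hδu y hy' x hx' (hyx.trans_le (min_le_left _ _))).le

/-- Weyl's lemma for `∂/∂z̄`. -/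
theorem WeakDbarOn.differentiableOn (H : WeakDbarOn u 0 U) (hU : IsOpen U)
    (hu : ContinuousOn u U) : DifferentiableOn ℂ u U := by
  intro z₀ hz₀
  obtain ⟨R, hR, hRU⟩ := Metric.nhds_basis_closedBall.mem_iff.1 (hU.mem_nhds hz₀)
  choose G hGd hGu using fun n : ℕ =>
    H.exists_differentiableOn_dist_le hu hR hRU (Nat.one_div_pos_of_nat (α := ℝ) (n := n))
  have hlim : TendstoUniformlyOn G u atTop (Metric.ball z₀ (R / 2)) := by
    refine Metric.tendstoUniformlyOn_iff.2 fun ε hε => ?_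
    filter_upwards [tendsto_one_div_add_atTop_nhds_zero_nat.eventually_lt_const hε] with n hn x hx
    exact (hGu n x hx).trans_lt hn
  exact ((hlim.tendstoLocallyUniformlyOn.differentiableOn (Eventually.of_forall hGd)
    Metric.isOpen_ball).differentiableAt
      (Metric.ball_mem_nhds z₀ (half_pos hR))).differentiableWithinAt

end Weyl

section Cutoff

/-- A smooth nondecreasing cut-off, used in the form `cutoff n (normSq z)`: it vanishes for
`|z| ≤ 1 / n` and equals `1` for `|z| ≥ √2 / n`. -/
noncomputable def cutoff (n : ℕ) (s : ℝ) : ℝ :=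
  Real.smoothTransition (n ^ 2 * s - 1)

variable (n : ℕ) (s : ℝ)

lemma contDiff_cutoff : ContDiff ℝ ∞ (cutoff n) :=
  Real.smoothTransition.contDiff.comp (by fun_prop)

lemma cutoff_nonneg : 0 ≤ cutoff n s :=
  Real.smoothTransition.nonneg _

lemma cutoff_le_one : cutoff n s ≤ 1 :=
  Real.smoothTransition.le_one _

lemma cutoff_eventuallyEq_zero : cutoff n =ᶠ[𝓝 0] 0 := by
  have : Tendsto (fun s : ℝ => (n : ℝ) ^ 2 * s - 1) (𝓝 0) (𝓝 ((n : ℝ) ^ 2 * 0 - 1)) :=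
    Continuous.tendsto (by fun_prop) (0 : ℝ)
  filter_upwards [this.eventually_le_const (show (n : ℝ) ^ 2 * 0 - 1 < 0 by norm_num)] with s hs
    using Real.smoothTransition.zero_of_nonpos hs

lemma tendsto_cutoff {s : ℝ} (hs : 0 < s) : Tendsto (fun n => cutoff n s) atTop (𝓝 1) := by
  have h : Tendsto (fun n : ℕ => (n : ℝ) ^ 2 * s - 1) atTop atTop :=
    tendsto_atTop_add_const_right _ _
      (((tendsto_pow_atTop two_ne_zero).comp tendsto_natCast_atTop_atTop).atTop_mul_const hs)
  refine tendsto_const_nhds.congr' ?_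
  filter_upwards [h.eventually_ge_atTop 1] with n hn
    using (Real.smoothTransition.one_of_one_le hn).symm

lemma deriv_cutoff : deriv (cutoff n) s = n ^ 2 * deriv (cutoff 1) (n ^ 2 * s) := by
  have h : cutoff n = fun s => cutoff 1 (n ^ 2 * s) := by ext s; simp [cutoff]
  rw [h, deriv_comp_mul_left, smul_eq_mul]

lemma deriv_cutoff_nonneg : 0 ≤ deriv (cutoff n) s :=
  Monotone.deriv_nonneg fun _ _ h =>
    Real.smoothTransition.monotone (by gcongr)

lemma continuous_deriv_cutoff : Continuous (deriv (cutoff n)) :=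
  (contDiff_cutoff n).continuous_deriv (by simp)

lemma hasCompactSupport_deriv_cutoff : HasCompactSupport (deriv (cutoff 1)) := by
  refine .intro (isCompact_Icc (a := (1 : ℝ)) (b := 2)) fun s hs => ?_
  have hc : ∀ c, cutoff 1 =ᶠ[𝓝 s] (fun _ => c) → deriv (cutoff 1) s = 0 := fun c h => by
    rw [h.deriv_eq, deriv_const]
  rcases lt_or_ge s 1 with h | h
  · refine hc 0 ?_
    filter_upwards [eventually_lt_nhds h] with t ht
      using Real.smoothTransition.zero_of_nonpos (by push_cast; linarith)
  · refine hc 1 ?_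
    filter_upwards [eventually_gt_nhds (not_le.1 fun h' => hs ⟨h, h'⟩)] with t ht
      using Real.smoothTransition.one_of_one_le (by push_cast; linarith)

lemma deriv_cutoff_eventuallyEq_zero : deriv (cutoff 1) =ᶠ[atTop] 0 :=
  (coclosedCompact_eq_cocompact (X := ℝ) ▸
    hasCompactSupport_iff_eventuallyEq.1 hasCompactSupport_deriv_cutoff).filter_mono
      atTop_le_cocompact

lemma exists_mul_deriv_cutoff_le : ∃ C, ∀ n s, |s * deriv (cutoff n) s| ≤ C := by
  obtain ⟨C, hC⟩ := (continuous_id.mul (continuous_deriv_cutoff 1)).bounded_above_of_compact_support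
    hasCompactSupport_deriv_cutoff.mul_left
  refine ⟨C, fun n s => le_of_eq_of_le ?_ (hC (n ^ 2 * s))⟩
  rw [deriv_cutoff, Real.norm_eq_abs, Pi.mul_apply, id]
  congr 1
  ring

lemma tendsto_mul_deriv_cutoff {s : ℝ} (hs : 0 ≤ s) :
    Tendsto (fun n => s * deriv (cutoff n) s) atTop (𝓝 0) := by
  rcases hs.eq_or_lt with rfl | hs
  · simp
  have hlim : Tendsto (fun n : ℕ => (n : ℝ) ^ 2 * s) atTop atTop :=
    ((tendsto_pow_atTop two_ne_zero).comp tendsto_natCast_atTop_atTop).atTop_mul_const hs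
  refine tendsto_const_nhds.congr' ?_
  filter_upwards [hlim.eventually deriv_cutoff_eventuallyEq_zero] with n hn
  rw [deriv_cutoff, hn, Pi.zero_apply, mul_zero, mul_zero]

lemma integrable_deriv_cutoff_normSq :
    Integrable fun w : ℂ => deriv (cutoff 1) (Complex.normSq w) := by
  refine ((continuous_deriv_cutoff 1).comp
    Complex.continuous_normSq).integrable_of_hasCompactSupport ?_
  rw [hasCompactSupport_iff_eventuallyEq, coclosedCompact_eq_cocompact]
  filter_upwards [((tendsto_pow_atTop two_ne_zero).comp
    (tendsto_norm_cocompact_atTop (E := ℂ))).eventually deriv_cutoff_eventuallyEq_zero] with w hw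
  simpa [Complex.normSq_eq_norm_sq] using hw

lemma integral_deriv_cutoff_normSq : ∫ w : ℂ, deriv (cutoff 1) (Complex.normSq w) = Real.pi := by
  have hderiv : ∀ y : ℝ, HasDerivAt (fun y => cutoff 1 (y ^ 2) / 2)
      (y * deriv (cutoff 1) (y ^ 2)) y := fun y => by
    have h := (((contDiff_cutoff 1).differentiable (by simp) (y ^ 2)).hasDerivAt.comp y
      (hasDerivAt_pow 2 y)).div_const 2
    refine h.congr_deriv ?_
    simp only [Nat.cast_ofNat, Nat.add_one_sub_one, pow_one]
    ring
  have hlim : Tendsto (fun y : ℝ => cutoff 1 (y ^ 2) / 2) atTop (𝓝 (1 / 2)) := by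
    refine tendsto_const_nhds.congr' ?_
    filter_upwards [(tendsto_pow_atTop two_ne_zero).eventually_ge_atTop (2 : ℝ)] with y hy
    rw [cutoff, Real.smoothTransition.one_of_one_le (by push_cast; linarith)]
  have hint := integrableOn_Ioi_deriv_of_nonneg' (fun y _ => hderiv y)
    (fun y (hy : 0 < y) => mul_nonneg hy.le (deriv_cutoff_nonneg 1 _)) hlim
  have hradial := integral_fun_norm_addHaar (volume : Measure ℂ) fun y => deriv (cutoff 1) (y ^ 2)
  simp only [Complex.normSq_eq_norm_sq]
  rw [hradial, Complex.finrank_real_complex, Measure.real, Complex.volume_ball]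
  simp only [Nat.reduceSub, pow_one, smul_eq_mul, nsmul_eq_mul]
  rw [integral_Ioi_of_hasDerivAt_of_tendsto' (fun y _ => hderiv y) hint hlim]
  simp only [(cutoff_eventuallyEq_zero 1).self_of_nhds, ne_eq, OfNat.ofNat_ne_zero,
    not_false_eq_true, zero_pow, Pi.zero_apply, Nat.cast_ofNat, ENNReal.ofReal_one, one_pow,
    one_mul, ENNReal.coe_toReal, NNReal.coe_real_pi, zero_div, sub_zero]
  ring

lemma tendsto_integral_mul_deriv_cutoff_normSq {b : ℂ → ℂ} (hb : Continuous b)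
    (hbc : HasCompactSupport b) :
    Tendsto (fun n => ∫ z, b z * (deriv (cutoff n) (Complex.normSq z) : ℝ)) atTop
      (𝓝 (Real.pi * b 0)) := by
  obtain ⟨M, hM⟩ := hb.bounded_above_of_compact_support hbc
  set κ : ℂ → ℝ := fun w => deriv (cutoff 1) (Complex.normSq w)
  have hκ : Integrable κ := integrable_deriv_cutoff_normSq
  have hκc : Continuous κ := (continuous_deriv_cutoff 1).comp Complex.continuous_normSq
  have hscale : ∀ᶠ n : ℕ in atTop, ∫ w, b ((n : ℝ)⁻¹ • w) * κ w =
      ∫ z, b z * (deriv (cutoff n) (Complex.normSq z) : ℝ) := by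
    filter_upwards [eventually_ne_atTop 0] with n hn
    have hn' : (n : ℝ) ≠ 0 := Nat.cast_ne_zero.2 hn
    have h := Measure.integral_comp_smul_of_nonneg volume
      (fun w => b ((n : ℝ)⁻¹ • w) * κ w) n (hR := n.cast_nonneg)
    rw [Complex.finrank_real_complex, eq_inv_smul_iff₀ (pow_ne_zero 2 hn'), ← integral_smul] at h
    rw [← h]
    congr 1 with z
    rw [inv_smul_smul₀ hn', deriv_cutoff, Complex.real_smul]
    simp only [κ, Complex.ofReal_pow, Complex.ofReal_natCast, Complex.normSq_eq_norm_sq,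
      Complex.real_smul, Complex.norm_mul, RCLike.norm_natCast, mul_pow, Complex.ofReal_mul]
    ring
  have hlim : ∫ w, b 0 * (κ w : ℂ) = Real.pi * b 0 := by
    rw [integral_const_mul, integral_complex_ofReal, integral_deriv_cutoff_normSq, mul_comm]
  rw [← hlim]
  refine Tendsto.congr' hscale (tendsto_integral_of_dominated_convergence
    (fun w => M * ‖κ w‖) (fun n => ?_) (hκ.norm.const_mul M)
    (fun n => ae_of_all _ fun w => ?_) (ae_of_all _ fun w => ?_))
  · exact (Continuous.mul (by fun_prop)
      (Complex.continuous_ofReal.comp hκc)).aestronglyMeasurable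
  · rw [norm_mul, Complex.norm_real]
    gcongr
    exact hM _
  · have hinv : Tendsto (fun n : ℕ => (n : ℝ)⁻¹ • w) atTop (𝓝 0) := by
      simpa only [zero_smul] using (tendsto_inv_atTop_nhds_zero_nat (𝕜 := ℝ)).smul_const w
    exact ((hb.tendsto' _ _ rfl).comp hinv).mul_const _

end Cutoff

section Rado

open ComplexConjugate

variable {U : Set ℂ} {F G φ : ℂ → ℂ} {κ : ℝ → ℝ}

lemma mul_comp_normSq_mul_eventuallyEq_zero (hU : IsOpen U) (hF : ContinuousOn F U)
    (hκ : κ =ᶠ[𝓝 0] 0) (hφ : tsupport φ ⊆ U) {z : ℂ} (hz : z ∉ U ∩ {z | F z ≠ 0}) :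
    (fun z => φ z * (κ (Complex.normSq (F z)) * G z)) =ᶠ[𝓝 z] 0 := by
  by_cases hzφ : z ∈ tsupport φ
  · have hFz : F z = 0 := by_contra fun h => hz ⟨hφ hzφ, h⟩
    have hlim : Tendsto (fun z => Complex.normSq (F z)) (𝓝 z) (𝓝 0) := by
      simpa [hFz, Function.comp_def] using
        (Complex.continuous_normSq.tendsto _).comp (hF.continuousAt (hU.mem_nhds (hφ hzφ)))
    filter_upwards [hlim.eventually hκ] with w hw
    simp [hw]
  · filter_upwards [notMem_tsupport_iff_eventuallyEq.1 hzφ] with w hw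
    simp [hw]

lemma contDiff_mul_comp_normSq_mul {N : ℕ∞} (hU : IsOpen U) (hF : ContinuousOn F U)
    (hFd : DifferentiableOn ℂ F (U ∩ {z | F z ≠ 0})) (hG : ContDiffOn ℝ N G (U ∩ {z | F z ≠ 0}))
    (hκ : ContDiff ℝ N κ) (hκ0 : κ =ᶠ[𝓝 0] 0) (hφ : ContDiff ℝ N φ) (hφU : tsupport φ ⊆ U) :
    ContDiff ℝ N fun z => φ z * (κ (Complex.normSq (F z)) * G z) := by
  have hW : IsOpen (U ∩ {z | F z ≠ 0}) := hF.isOpen_inter_preimage hU isOpen_ne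
  refine contDiff_iff_contDiffAt.2 fun z => ?_
  by_cases hz : z ∈ U ∩ {z | F z ≠ 0}
  · have hFz : ContDiffAt ℝ N F z :=
      ((hFd.contDiffOn hW).contDiffAt (hW.mem_nhds hz)).restrict_scalars ℝ
    have hs : ContDiffAt ℝ N (fun z => Complex.normSq (F z)) z := by
      simp only [Complex.normSq_eq_norm_sq]
      exact hFz.norm_sq ℝ
    exact hφ.contDiffAt.mul (((Complex.ofRealCLM.contDiff.comp hκ).contDiffAt.comp z hs).mul
      (hG.contDiffAt (hW.mem_nhds hz)))
  · exact contDiffAt_const.congr_of_eventuallyEq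
      (mul_comp_normSq_mul_eventuallyEq_zero hU hF hκ0 hφU hz)

lemma integrable_mul_comp_normSq_mul (hU : IsOpen U) (hF : ContinuousOn F U)
    (hFd : DifferentiableOn ℂ F (U ∩ {z | F z ≠ 0})) (hG : ContinuousOn G (U ∩ {z | F z ≠ 0}))
    (hκ : Continuous κ) (hκ0 : κ =ᶠ[𝓝 0] 0) (hφ : Continuous φ) (hφc : HasCompactSupport φ)
    (hφU : tsupport φ ⊆ U) :
    Integrable fun z => φ z * (κ (Complex.normSq (F z)) * G z) :=
  (contDiff_mul_comp_normSq_mul (N := 0) hU hF hFd (contDiffOn_zero.2 hG) (contDiff_zero.2 hκ) hκ0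
    (contDiff_zero.2 hφ) hφU).continuous.integrable_of_hasCompactSupport hφc.mul_right

lemma deriv_eventuallyEq_zero (h : κ =ᶠ[𝓝 0] 0) : deriv κ =ᶠ[𝓝 0] 0 := by
  filter_upwards [h.deriv] with s hs
  simpa using hs

lemma dzbar_mul_comp_normSq_mul (hU : IsOpen U) (hF : ContinuousOn F U)
    (hFd : DifferentiableOn ℂ F (U ∩ {z | F z ≠ 0}))
    (hG : DifferentiableOn ℝ G (U ∩ {z | F z ≠ 0})) (hκ : Differentiable ℝ κ)
    (hκ0 : κ =ᶠ[𝓝 0] 0) (hφ : IsTestFunction φ U) (z : ℂ) :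
    dzbar (fun z => φ z * (κ (Complex.normSq (F z)) * G z)) z =
      dzbar φ z * (κ (Complex.normSq (F z)) * G z) +
        φ z * (deriv κ (Complex.normSq (F z)) * (F z * conj (deriv F z) * G z)) +
        φ z * (κ (Complex.normSq (F z)) * dzbar G z) := by
  have hW : IsOpen (U ∩ {z | F z ≠ 0}) := hF.isOpen_inter_preimage hU isOpen_ne
  by_cases hz : z ∈ U ∩ {z | F z ≠ 0}
  · have hFz : DifferentiableAt ℂ F z := hFd.differentiableAt (hW.mem_nhds hz)
    have hGz : DifferentiableAt ℝ G z := hG.differentiableAt (hW.mem_nhds hz)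
    have hκz : DifferentiableAt ℝ (fun z => (κ (Complex.normSq (F z)) : ℂ)) z := by
      have hFz' : DifferentiableAt ℝ F z := hFz.restrictScalars ℝ
      simp only [Complex.normSq_apply]
      fun_prop
    rw [dzbar_mul (hφ.differentiable z) (hκz.fun_mul hGz), dzbar_mul hκz hGz,
      dzbar_ofReal_comp_normSq hκ hFz]
    ring
  · rw [dzbar_congr (mul_comp_normSq_mul_eventuallyEq_zero hU hF hκ0 hφ.tsupport_subset hz),
      show dzbar 0 z = 0 from dzbar_const 0]
    by_cases hzU : z ∈ U
    · have hFz : F z = 0 := by_contra fun h => hz ⟨hzU, h⟩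
      simp [hFz, hκ0.self_of_nhds]
    · simp [hφ.eq_zero hzU, hφ.dzbar_eq_zero hzU]

lemma energy_le_re {a b d : ℂ} {ρ η η' : ℝ} (hη₀ : 0 ≤ η) (hη₁ : η ≤ 1) :
    ρ ^ 2 * (Complex.normSq b * η' * Complex.normSq d) - Complex.normSq b * Complex.normSq a ≤
      ((a * ρ + ρ * a) * (η * (conj b * d)) + ρ * ρ * (η' * (b * conj d * (conj b * d))) +
        ρ * ρ * (η * (conj d * d))).re := by
  have hsq : 0 ≤ η * Complex.normSq (a * conj b + ρ * conj d) :=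
    mul_nonneg hη₀ (Complex.normSq_nonneg _)
  have hη : η * (Complex.normSq b * Complex.normSq a) ≤ Complex.normSq b * Complex.normSq a :=
    mul_le_of_le_one_left (mul_nonneg (Complex.normSq_nonneg _) (Complex.normSq_nonneg _)) hη₁
  simp only [Complex.normSq_apply, Complex.add_re, Complex.add_im, Complex.mul_re, Complex.mul_im,
    Complex.conj_re, Complex.conj_im, Complex.ofReal_re, Complex.ofReal_im] at hsq hη ⊢
  linear_combination hsq + hη


lemma integrable_normSq_deriv_mul_cutoff (hU : IsOpen U) (hF : ContinuousOn F U)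
    (hFd : DifferentiableOn ℂ F (U ∩ {z | F z ≠ 0})) {ρ : ℂ → ℝ}
    (hρ : IsTestFunction (fun z => (ρ z : ℂ)) U) (n : ℕ) :
    Integrable fun z => ρ z ^ 2 * (Complex.normSq (F z) *
      deriv (cutoff n) (Complex.normSq (F z)) * Complex.normSq (deriv F z)) := by
  have hW : IsOpen (U ∩ {z | F z ≠ 0}) := hF.isOpen_inter_preimage hU isOpen_ne
  have hF' := (hFd.deriv hW).continuousOn
  have hκ0 : (fun s => s * deriv (cutoff n) s) =ᶠ[𝓝 0] 0 := by
    filter_upwards [deriv_eventuallyEq_zero (cutoff_eventuallyEq_zero n)] with s hs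
    simp [hs]
  have hρρ := hρ.mul_right hρ.contDiff
  have h := (integrable_mul_comp_normSq_mul hU hF hFd
    (hF'.mul (Complex.continuous_conj.comp_continuousOn hF'))
    (continuous_id.mul (continuous_deriv_cutoff n)) hκ0 hρρ.contDiff.continuous
    hρρ.hasCompactSupport hρρ.tsupport_subset).re
  refine h.congr (ae_of_all _ fun z => ?_)
  simp [Complex.mul_conj, ← Complex.ofReal_mul, sq]

lemma energy_le_re_dzbar (hU : IsOpen U) (hF : ContinuousOn F U)
    (hFd : DifferentiableOn ℂ F (U ∩ {z | F z ≠ 0})) {ρ : ℂ → ℝ}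
    (hρ : IsTestFunction (fun z => (ρ z : ℂ)) U) (n : ℕ) (z : ℂ) :
    ρ z ^ 2 * (Complex.normSq (F z) * deriv (cutoff n) (Complex.normSq (F z)) *
        Complex.normSq (deriv F z)) -
      Complex.normSq (F z) * Complex.normSq (dzbar (fun z => (ρ z : ℂ)) z) ≤
    (dzbar (fun z => (ρ z * ρ z : ℂ) *
      (cutoff n (Complex.normSq (F z)) * (conj (F z) * deriv F z))) z).re := by
  have hW : IsOpen (U ∩ {z | F z ≠ 0}) := hF.isOpen_inter_preimage hU isOpen_ne
  have hFr := hFd.restrictScalars ℝ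
  have hF'r := (hFd.deriv hW).restrictScalars ℝ
  have hκ0 := cutoff_eventuallyEq_zero n
  rw [dzbar_mul_comp_normSq_mul hU hF hFd (by fun_prop)
    ((contDiff_cutoff n).differentiable (by simp)) hκ0 (hρ.mul_right hρ.contDiff),
    dzbar_mul (hρ.differentiable z) (hρ.differentiable z)]
  refine (energy_le_re (η := cutoff n (Complex.normSq (F z))) (cutoff_nonneg _ _)
    (cutoff_le_one _ _)).trans_eq ?_
  by_cases hz : z ∈ U ∩ {z | F z ≠ 0}
  · rw [dzbar_conj_mul (hFd.differentiableAt (hW.mem_nhds hz))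
      ((hFd.deriv hW).differentiableAt (hW.mem_nhds hz))]
  · by_cases hzU : z ∈ U
    · have hFz : F z = 0 := by_contra fun h => hz ⟨hzU, h⟩
      simp [hFz, hκ0.self_of_nhds]
    · simp [hρ.dzbar_eq_zero hzU, Complex.ofReal_eq_zero.1 (hρ.eq_zero hzU)]

lemma integrable_normSq_mul_normSq_dzbar (hF : ContinuousOn F U) (hU : IsOpen U)
    (hφ : IsTestFunction φ U) :
    Integrable fun z => Complex.normSq (F z) * Complex.normSq (dzbar φ z) := by
  have hFF := (hF.mul (Complex.continuous_conj.comp_continuousOn hF)).locallyIntegrableOn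
    hU.measurableSet (μ := volume)
  refine (integrable_mul_of_tsupport_subset hFF
    (hφ.continuous_dzbar.mul (Complex.continuous_conj.comp hφ.continuous_dzbar))
    (hasCompactSupport_dzbar hφ.hasCompactSupport).mul_right
    (tsupport_mul_subset_left.trans ((tsupport_dzbar_subset φ).trans hφ.tsupport_subset))).re.congr
    (ae_of_all _ fun z => ?_)
  simp [Complex.mul_conj, ← Complex.ofReal_mul]

/-- Caccioppoli's inequality for `F` off its zeros, with a bound that does not depend on the
cut-off near the zeros. -/
lemma integral_normSq_deriv_mul_cutoff_le (hU : IsOpen U) (hF : ContinuousOn F U)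
    (hFd : DifferentiableOn ℂ F (U ∩ {z | F z ≠ 0})) {ρ : ℂ → ℝ}
    (hρ : IsTestFunction (fun z => (ρ z : ℂ)) U) (n : ℕ) :
    ∫ z, ρ z ^ 2 * (Complex.normSq (F z) * deriv (cutoff n) (Complex.normSq (F z)) *
        Complex.normSq (deriv F z)) ≤
      ∫ z, Complex.normSq (F z) * Complex.normSq (dzbar (fun z => (ρ z : ℂ)) z) := by
  have hW : IsOpen (U ∩ {z | F z ≠ 0}) := hF.isOpen_inter_preimage hU isOpen_ne
  have hρρ := hρ.mul_right hρ.contDiff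
  have hsmooth := fun {H : ℂ → ℂ} (h : DifferentiableOn ℂ H (U ∩ {z | F z ≠ 0})) =>
    (h.contDiffOn hW (n := 1)).restrict_scalars ℝ
  have hG : ContDiffOn ℝ 1 (fun z => conj (F z) * deriv F z) (U ∩ {z | F z ≠ 0}) :=
    (Complex.conjCLE.contDiff.comp_contDiffOn (hsmooth hFd)).mul (hsmooth (hFd.deriv hW))
  have hΦ := contDiff_mul_comp_normSq_mul (N := 1) hU hF hFd hG
    ((contDiff_cutoff n).of_le (by simp)) (cutoff_eventuallyEq_zero n)
    (hρρ.contDiff.of_le (by simp)) hρρ.tsupport_subset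
  have hΦc := hρρ.hasCompactSupport.mul_right
    (f' := fun z => (cutoff n (Complex.normSq (F z)) : ℂ) * (conj (F z) * deriv F z))
  have hbound := integrable_normSq_mul_normSq_dzbar hF hU hρ
  have henergy := integrable_normSq_deriv_mul_cutoff hU hF hFd hρ n
  rw [← sub_nonpos, ← integral_sub henergy hbound]
  calc _ ≤ ∫ z, (dzbar (fun z => (ρ z * ρ z : ℂ) *
        (cutoff n (Complex.normSq (F z)) * (conj (F z) * deriv F z))) z).re :=
        integral_mono (henergy.sub hbound) (integrable_dzbar hΦ hΦc).re
          (energy_le_re_dzbar hU hF hFd hρ n)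
    _ = 0 := by
        rw [← RCLike.re_eq_complex_re, integral_re (integrable_dzbar hΦ hΦc),
          integral_dzbar_eq_zero hΦ hΦc, map_zero]

lemma integral_dzbar_mul_cutoff_mul (hU : IsOpen U) (hF : ContinuousOn F U)
    (hFd : DifferentiableOn ℂ F (U ∩ {z | F z ≠ 0}))
    (hG : DifferentiableOn ℂ G (U ∩ {z | F z ≠ 0})) (hφ : IsTestFunction φ U) (n : ℕ) :
    ∫ z, dzbar φ z * (cutoff n (Complex.normSq (F z)) * G z) =
      -∫ z, φ z * (deriv (cutoff n) (Complex.normSq (F z)) * (F z * conj (deriv F z) * G z)) := by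
  have hW : IsOpen (U ∩ {z | F z ≠ 0}) := hF.isOpen_inter_preimage hU isOpen_ne
  have hκ0 := cutoff_eventuallyEq_zero n
  have hF' := (hFd.deriv hW).continuousOn
  have hsmooth : ContDiff ℝ 1 fun z => φ z * (cutoff n (Complex.normSq (F z)) * G z) :=
    contDiff_mul_comp_normSq_mul (N := 1) hU hF hFd ((hG.contDiffOn hW).restrict_scalars ℝ)
      ((contDiff_cutoff n).of_le (by simp)) hκ0 (hφ.contDiff.of_le (by simp)) hφ.tsupport_subset
  have hleibniz : ∀ z, dzbar (fun z => φ z * (cutoff n (Complex.normSq (F z)) * G z)) z =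
      dzbar φ z * (cutoff n (Complex.normSq (F z)) * G z) +
        φ z * (deriv (cutoff n) (Complex.normSq (F z)) * (F z * conj (deriv F z) * G z)) :=
    fun z => by
      rw [dzbar_mul_comp_normSq_mul hU hF hFd (hG.restrictScalars ℝ)
        ((contDiff_cutoff n).differentiable (by simp)) hκ0 hφ, add_eq_left]
      by_cases hz : z ∈ U ∩ {z | F z ≠ 0}
      · rw [dzbar_eq_zero_of_differentiableAt (hG.differentiableAt (hW.mem_nhds hz)), mul_zero,
          mul_zero]
      · by_cases hzU : z ∈ U
        · have hFz : F z = 0 := by_contra fun h => hz ⟨hzU, h⟩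
          simp [hFz, hκ0.self_of_nhds]
        · rw [hφ.eq_zero hzU, zero_mul]
  have hzero := integral_dzbar_eq_zero hsmooth hφ.hasCompactSupport.mul_right
  simp only [hleibniz] at hzero
  rw [integral_add] at hzero
  · exact eq_neg_of_add_eq_zero_left hzero
  · exact integrable_mul_comp_normSq_mul hU hF hFd hG.continuousOn (contDiff_cutoff n).continuous
      hκ0 hφ.continuous_dzbar (hasCompactSupport_dzbar hφ.hasCompactSupport)
      ((tsupport_dzbar_subset φ).trans hφ.tsupport_subset)
  · exact integrable_mul_comp_normSq_mul hU hF hFd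
      (((hF.mono inter_subset_left).mul (Complex.continuous_conj.comp_continuousOn hF')).mul
        hG.continuousOn) (continuous_deriv_cutoff n) (deriv_eventuallyEq_zero hκ0)
      hφ.contDiff.continuous hφ.hasCompactSupport hφ.tsupport_subset

lemma tendsto_integral_cutoff_mul
    (hm : ∀ n, AEStronglyMeasurable fun z => (cutoff n (Complex.normSq (F z)) : ℂ) * G z)
    (hG : Integrable G) (hF : ∀ᵐ z, F z = 0 → G z = 0) :
    Tendsto (fun n => ∫ z, (cutoff n (Complex.normSq (F z)) : ℂ) * G z) atTop
      (𝓝 (∫ z, G z)) := by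
  refine tendsto_integral_of_dominated_convergence (fun z => ‖G z‖) hm hG.norm
    (fun n => ae_of_all _ fun z => ?_) ?_
  · rw [norm_mul, Complex.norm_of_nonneg (cutoff_nonneg _ _)]
    exact mul_le_of_le_one_left (norm_nonneg _) (cutoff_le_one _ _)
  · filter_upwards [hF] with z hz
    by_cases hFz : F z = 0
    · simp [hz hFz]
    · simpa using ((Complex.continuous_ofReal.tendsto _).comp
        (tendsto_cutoff (Complex.normSq_pos.2 hFz))).mul_const (G z)

lemma integrable_normSq_mul_deriv_cutoff (hU : IsOpen U) (hF : ContinuousOn F U)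
    (hFd : DifferentiableOn ℂ F (U ∩ {z | F z ≠ 0})) {ρ : ℂ → ℝ}
    (hρ : IsTestFunction (fun z => (ρ z : ℂ)) U) (n : ℕ) :
    Integrable fun z => ρ z ^ 2 * (Complex.normSq (F z) *
      deriv (cutoff n) (Complex.normSq (F z))) := by
  have hκ0 : (fun s => s * deriv (cutoff n) s) =ᶠ[𝓝 0] 0 := by
    filter_upwards [deriv_eventuallyEq_zero (cutoff_eventuallyEq_zero n)] with s hs
    simp [hs]
  have hρρ := hρ.mul_right hρ.contDiff
  refine (integrable_mul_comp_normSq_mul hU hF hFd (continuousOn_const (c := 1))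
    (continuous_id.mul (continuous_deriv_cutoff n)) hκ0 hρρ.contDiff.continuous
    hρρ.hasCompactSupport hρρ.tsupport_subset).re.congr (ae_of_all _ fun z => ?_)
  simp [sq]

lemma tendsto_integral_normSq_mul_deriv_cutoff (hU : IsOpen U) (hF : ContinuousOn F U)
    (hFd : DifferentiableOn ℂ F (U ∩ {z | F z ≠ 0})) {ρ : ℂ → ℝ}
    (hρ : IsTestFunction (fun z => (ρ z : ℂ)) U) :
    Tendsto (fun n => ∫ z, ρ z ^ 2 * (Complex.normSq (F z) *
      deriv (cutoff n) (Complex.normSq (F z)))) atTop (𝓝 0) := by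
  obtain ⟨C, hC⟩ := exists_mul_deriv_cutoff_le
  have hρρ := hρ.mul_right hρ.contDiff
  have hbound : Integrable fun z => C * ‖(ρ z * ρ z : ℂ)‖ :=
    (hρρ.contDiff.continuous.integrable_of_hasCompactSupport hρρ.hasCompactSupport).norm.const_mul C
  rw [← integral_zero ℂ ℝ]
  refine tendsto_integral_of_dominated_convergence _
    (fun n => (integrable_normSq_mul_deriv_cutoff hU hF hFd hρ n).aestronglyMeasurable) hbound
    (fun n => ae_of_all _ fun z => ?_) (ae_of_all _ fun z => ?_)
  · rw [← sq, ← Complex.ofReal_pow, Complex.norm_real, norm_mul, mul_comm]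
    gcongr
    exact hC n _
  · simpa using (tendsto_mul_deriv_cutoff (Complex.normSq_nonneg (F z))).const_mul (ρ z ^ 2)

lemma norm_integral_mul_deriv_cutoff_le (hU : IsOpen U) (hF : ContinuousOn F U)
    (hFd : DifferentiableOn ℂ F (U ∩ {z | F z ≠ 0})) {ρ : ℂ → ℝ}
    (hρ : IsTestFunction (fun z => (ρ z : ℂ)) U) (hφρ : ∀ z, ‖φ z‖ ≤ ρ z ^ 2) {t : ℝ} (ht : 0 < t)
    (n : ℕ) :
    ‖∫ z, φ z * (deriv (cutoff n) (Complex.normSq (F z)) * (F z * conj (deriv F z) * F z))‖ ≤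
      t * (∫ z, Complex.normSq (F z) * Complex.normSq (dzbar (fun z => (ρ z : ℂ)) z)) +
        t⁻¹ * ∫ z, ρ z ^ 2 * (Complex.normSq (F z) * deriv (cutoff n) (Complex.normSq (F z))) := by
  have henergy := integrable_normSq_deriv_mul_cutoff hU hF hFd hρ n
  have hweight := integrable_normSq_mul_deriv_cutoff hU hF hFd hρ n
  have hamgm : ∀ r : ℝ, r ≤ t * r ^ 2 + t⁻¹ := fun r => by
    have hsq : 0 ≤ t⁻¹ * (t * r - 1) ^ 2 := by positivity
    have hexpand : t⁻¹ * (t * r - 1) ^ 2 = t * r ^ 2 - 2 * r + t⁻¹ := by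
      field_simp
      ring
    have hnonneg : 0 ≤ t * r ^ 2 + t⁻¹ := by positivity
    linarith
  refine (norm_integral_le_of_norm_le ((henergy.const_mul t).add (hweight.const_mul t⁻¹))
    (ae_of_all _ fun z => ?_)).trans ?_
  · have hw : 0 ≤ ρ z ^ 2 * (Complex.normSq (F z) * deriv (cutoff n) (Complex.normSq (F z))) :=
      mul_nonneg (sq_nonneg _) (mul_nonneg (Complex.normSq_nonneg _) (deriv_cutoff_nonneg _ _))
    calc _ = ‖φ z‖ * (Complex.normSq (F z) * deriv (cutoff n) (Complex.normSq (F z))) *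
          ‖deriv F z‖ := by
          simp only [norm_mul, Complex.norm_of_nonneg (deriv_cutoff_nonneg n _), RCLike.norm_conj,
            Complex.normSq_eq_norm_sq]
          ring
      _ ≤ ρ z ^ 2 * (Complex.normSq (F z) * deriv (cutoff n) (Complex.normSq (F z))) *
          (t * ‖deriv F z‖ ^ 2 + t⁻¹) := by
          gcongr
          · exact mul_nonneg (Complex.normSq_nonneg _) (deriv_cutoff_nonneg _ _)
          · exact hφρ z
          · exact hamgm _
      _ = _ := by
          simp only [Complex.normSq_eq_norm_sq, Pi.add_apply]
          ring
  · simp only [Pi.add_apply]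
    rw [integral_add (henergy.const_mul t) (hweight.const_mul t⁻¹), integral_const_mul,
      integral_const_mul]
    exact add_le_add_left (mul_le_mul_of_nonneg_left
      (integral_normSq_deriv_mul_cutoff_le hU hF hFd hρ n) ht.le) _

lemma integral_dzbar_mul_eq_zero_of_norm_le (hU : IsOpen U) (hF : ContinuousOn F U)
    (hFd : DifferentiableOn ℂ F (U ∩ {z | F z ≠ 0})) {ρ : ℂ → ℝ}
    (hρ : IsTestFunction (fun z => (ρ z : ℂ)) U) (hφ : IsTestFunction φ U)
    (hφρ : ∀ z, ‖φ z‖ ≤ ρ z ^ 2) :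
    ∫ z, dzbar φ z * F z = 0 := by
  set C := ∫ z, Complex.normSq (F z) * Complex.normSq (dzbar (fun z => (ρ z : ℂ)) z)
  have hφF : Integrable fun z => dzbar φ z * F z := by
    simpa only [mul_comm] using hφ.integrable_mul_dzbar (hF.locallyIntegrableOn hU.measurableSet)
  have hlim := tendsto_integral_cutoff_mul (F := F) (G := fun z => dzbar φ z * F z)
    (fun n => by
      simpa only [mul_left_comm] using (integrable_mul_comp_normSq_mul hU hF hFd
        (hF.mono inter_subset_left) (contDiff_cutoff n).continuous (cutoff_eventuallyEq_zero n)
        hφ.continuous_dzbar (hasCompactSupport_dzbar hφ.hasCompactSupport)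
        ((tsupport_dzbar_subset φ).trans hφ.tsupport_subset)).aestronglyMeasurable) hφF
    (ae_of_all _ fun z hz => by rw [hz, mul_zero])
  simp only [mul_left_comm (Complex.ofReal _)] at hlim
  have hle : ∀ t > 0, ‖∫ z, dzbar φ z * F z‖ ≤ t * C := fun t ht => by
    have hright := ((tendsto_integral_normSq_mul_deriv_cutoff hU hF hFd hρ).const_mul
      t⁻¹).const_add (t * C)
    rw [mul_zero, add_zero] at hright
    refine le_of_tendsto_of_tendsto' hlim.norm hright fun n => ?_
    rw [integral_dzbar_mul_cutoff_mul hU hF hFd hFd hφ, norm_neg]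
    exact norm_integral_mul_deriv_cutoff_le hU hF hFd hρ hφρ ht n
  have hzero : Tendsto (fun t : ℝ => t * C) (𝓝[>] 0) (𝓝 0) :=
    (Continuous.tendsto' (by fun_prop) 0 0 (zero_mul C)).mono_left nhdsWithin_le_nhds
  exact norm_le_zero_iff.1 (ge_of_tendsto hzero (eventually_mem_nhdsWithin.mono hle))

/-- Radó's theorem. -/
theorem differentiableOn_of_differentiableOn_ne_zero (hU : IsOpen U) (hF : ContinuousOn F U)
    (hFd : DifferentiableOn ℂ F (U ∩ {z | F z ≠ 0})) : DifferentiableOn ℂ F U := by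
  intro z₀ hz₀
  obtain ⟨R, hR, hRU⟩ := Metric.nhds_basis_closedBall.mem_iff.1 (hU.mem_nhds hz₀)
  let β : ContDiffBump z₀ := ⟨R / 2, R, half_pos hR, half_lt_self hR⟩
  have hball : Metric.ball z₀ (R / 2) ⊆ U :=
    ((Metric.ball_subset_ball (half_le_self hR.le)).trans Metric.ball_subset_closedBall).trans hRU
  have hβ : IsTestFunction (fun z => (β z : ℂ)) U :=
    .ofReal β.contDiff β.hasCompactSupport (β.tsupport_eq.subset.trans hRU)
  have hweak : WeakDbarOn F 0 (Metric.ball z₀ (R / 2)) := by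
    refine ⟨(hF.mono hball).locallyIntegrableOn Metric.isOpen_ball.measurableSet,
      locallyIntegrable_zero.locallyIntegrableOn _, fun φ hφ => ?_⟩
    obtain ⟨M, hM⟩ := hφ.contDiff.continuous.bounded_above_of_compact_support hφ.hasCompactSupport
    have hρ : IsTestFunction (fun z => ((β z * √M : ℝ) : ℂ)) U := by
      simpa only [Complex.ofReal_mul] using hβ.mul_right (contDiff_const (c := (√M : ℂ)))
    have hφρ : ∀ z, ‖φ z‖ ≤ (β z * √M) ^ 2 := fun z => by
      by_cases hz : z ∈ Metric.ball z₀ (R / 2)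
      · rw [β.one_of_mem_closedBall (Metric.ball_subset_closedBall hz), one_mul,
          Real.sq_sqrt ((norm_nonneg _).trans (hM z))]
        exact hM z
      · rw [hφ.eq_zero hz, norm_zero]
        positivity
    simpa only [Pi.zero_apply, zero_mul, add_zero, mul_comm (F _)] using
      integral_dzbar_mul_eq_zero_of_norm_le hU hF hFd hρ (hφ.mono hball) hφρ
  exact ((hweak.differentiableOn Metric.isOpen_ball (hF.mono hball)).differentiableAt
    (Metric.ball_mem_nhds z₀ (half_pos hR))).differentiableWithinAt

end Rado

section CauchyPompeiu

lemma locallyIntegrable_inv : LocallyIntegrable fun w : ℂ => w⁻¹ := by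
  refine locallyIntegrable_of_norm_le_rpow (C := 1) (α := 1) (by simp) (by simp)
    (Eventually.of_forall fun w => ?_) (by fun_prop)
  rw [norm_inv, Real.rpow_neg_one, one_mul]

lemma locallyIntegrable_inv_sub (a : ℂ) : LocallyIntegrable fun w : ℂ => (w - a)⁻¹ := by
  have hmap : Measure.map (Homeomorph.subRight a) (volume : Measure ℂ) = volume :=
    map_sub_right_eq_self volume a
  exact (locallyIntegrable_map_homeomorph (μ := volume) (Homeomorph.subRight a)).1
    (hmap.symm ▸ locallyIntegrable_inv)

/-- The Cauchy–Pompeiu formula for test functions. -/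
lemma IsTestFunction.integral_inv_mul_dzbar {b : ℂ → ℂ} (hb : IsTestFunction b univ) :
    ∫ w, w⁻¹ * dzbar b w = -Real.pi * b 0 := by
  have hinv : DifferentiableOn ℂ (fun z : ℂ => z⁻¹) (univ ∩ {z | z ≠ 0}) := fun z hz =>
    (differentiableAt_inv hz.2).differentiableWithinAt
  have hint : Integrable fun z => dzbar b z * z⁻¹ := by
    simpa only [mul_comm] using hb.integrable_mul_dzbar
      (locallyIntegrable_inv.locallyIntegrableOn univ)
  have hleft := tendsto_integral_cutoff_mul (F := fun z => z) (fun n =>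
    (Complex.continuous_ofReal.comp ((contDiff_cutoff n).continuous.comp
      Complex.continuous_normSq)).aestronglyMeasurable.mul hint.aestronglyMeasurable) hint
    (ae_of_all _ fun z hz => by rw [hz, inv_zero, mul_zero])
  simp only [mul_left_comm (Complex.ofReal _)] at hleft
  have hright := (tendsto_integral_mul_deriv_cutoff_normSq hb.contDiff.continuous
    hb.hasCompactSupport).neg
  simp only [mul_comm _⁻¹]
  rw [neg_mul]
  refine tendsto_nhds_unique hleft (hright.congr fun n => ?_)
  rw [integral_dzbar_mul_cutoff_mul (F := fun z => z) isOpen_univ continuousOn_id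
    differentiableOn_id hinv hb]
  congr 2 with z
  rcases eq_or_ne z 0 with rfl | hz
  · simp [(deriv_eventuallyEq_zero (cutoff_eventuallyEq_zero n)).self_of_nhds]
  · simp [hz]

end CauchyPompeiu

namespace IsTestFunction

variable {u φ : ℂ → ℂ} {U : Set ℂ} {a : ℂ}

lemma mul_cutoff_normSq_sub (hφ : IsTestFunction φ U) (n : ℕ) (a : ℂ) :
    IsTestFunction (fun z => φ z * cutoff n (Complex.normSq (z - a))) (U \ {a}) := by
  have hsq : ContDiff ℝ ∞ fun z => Complex.normSq (z - a) := by
    simp only [Complex.normSq_eq_norm_sq]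
    exact (contDiff_id.sub contDiff_const).norm_sq ℝ
  have h := hφ.mul_right (Complex.ofRealCLM.contDiff.comp ((contDiff_cutoff n).comp hsq))
  refine ⟨h.contDiff, h.hasCompactSupport, subset_sdiff_singleton h.tsupport_subset ?_⟩
  have hlim : Tendsto (fun z => Complex.normSq (z - a)) (𝓝 a) (𝓝 0) :=
    hsq.continuous.tendsto' _ _ (by simp)
  refine notMem_tsupport_iff_eventuallyEq.2 ?_
  filter_upwards [hlim.eventually (cutoff_eventuallyEq_zero n)] with z hz
  simp [hz]

lemma dzbar_mul_cutoff_normSq_sub (hφ : IsTestFunction φ U) (n : ℕ) (a z : ℂ) :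
    dzbar (fun z => φ z * cutoff n (Complex.normSq (z - a))) z =
      dzbar φ z * cutoff n (Complex.normSq (z - a)) +
        φ z * (deriv (cutoff n) (Complex.normSq (z - a)) * (z - a)) := by
  have hη : Differentiable ℝ (cutoff n) := (contDiff_cutoff n).differentiable (by simp)
  have hsub : DifferentiableAt ℂ (fun z => z - a) z := by fun_prop
  have hderiv : deriv (fun z => z - a) z = 1 := by simp
  rw [dzbar_mul (hφ.differentiable z), dzbar_ofReal_comp_normSq hη hsub, hderiv, map_one, mul_one]
  have hsq : DifferentiableAt ℝ (fun z => Complex.normSq (z - a)) z := by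
    simp only [Complex.normSq_apply]
    fun_prop
  exact Complex.ofRealCLM.differentiableAt.comp z ((hη _).comp z hsq)

lemma tendsto_integral_mul_deriv_cutoff (hφ : IsTestFunction φ U) (hu : LocallyIntegrableOn u U)
    (hua : LocallyIntegrableOn (fun z => (z - a)⁻¹ * u z) U) :
    Tendsto (fun n => ∫ z, u z * φ z * (deriv (cutoff n) (Complex.normSq (z - a)) * (z - a))) atTop
      (𝓝 0) := by
  obtain ⟨C, hC⟩ := exists_mul_deriv_cutoff_le
  have hfactor : ∀ n z, u z * φ z * (deriv (cutoff n) (Complex.normSq (z - a)) * (z - a)) =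
      (z - a)⁻¹ * u z * φ z *
        ((z - a) ^ 2 * deriv (cutoff n) (Complex.normSq (z - a))) := fun n z => by
    rcases eq_or_ne (z - a) 0 with hz | hz
    · simp [hz]
    · field_simp
  have hnorm : ∀ n z, ‖(z - a) ^ 2 * ((deriv (cutoff n) (Complex.normSq (z - a)) : ℝ) : ℂ)‖ =
      |Complex.normSq (z - a) * deriv (cutoff n) (Complex.normSq (z - a))| := fun n z => by
    rw [norm_mul, norm_pow, ← Complex.normSq_eq_norm_sq, Complex.norm_real, Real.norm_eq_abs,
      abs_mul, abs_of_nonneg (Complex.normSq_nonneg _)]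
  have hcont : ∀ n, Continuous fun z =>
      ((deriv (cutoff n) (Complex.normSq (z - a)) : ℝ) : ℂ) * (z - a) := fun n =>
    (Complex.continuous_ofReal.comp ((continuous_deriv_cutoff n).comp
      (Complex.continuous_normSq.comp (by fun_prop)))).mul (by fun_prop)
  rw [← integral_zero ℂ ℂ (μ := volume)]
  refine tendsto_integral_of_dominated_convergence (fun z => ‖(z - a)⁻¹ * u z * φ z‖ * C)
    (fun n => (hφ.integrable_mul hu).aestronglyMeasurable.mul (hcont n).aestronglyMeasurable)
    ((hφ.integrable_mul hua).norm.mul_const C) (fun n => ae_of_all _ fun z => ?_)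
    (ae_of_all _ fun z => ?_)
  · rw [hfactor, norm_mul, hnorm]
    exact mul_le_mul_of_nonneg_left (hC n _) (norm_nonneg _)
  · simp only [hfactor]
    rw [← mul_zero ((z - a)⁻¹ * u z * φ z)]
    refine (tendsto_zero_iff_norm_tendsto_zero.2 ?_).const_mul _
    simp only [hnorm]
    simpa using (tendsto_mul_deriv_cutoff (Complex.normSq_nonneg (z - a))).abs

end IsTestFunction

namespace WeakDbarOn

variable {u h : ℂ → ℂ} {U : Set ℂ} {a : ℂ}

lemma of_diff_singleton (H : WeakDbarOn u h (U \ {a})) (hU : IsOpen U) (hu : ContinuousOn u U)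
    (hh : LocallyIntegrableOn h U) : WeakDbarOn u h U := by
  have huloc := hu.locallyIntegrableOn hU.measurableSet (μ := volume)
  have hua : LocallyIntegrableOn (fun z => (z - a)⁻¹ * u z) U :=
    ((locallyIntegrable_inv_sub a).locallyIntegrableOn U).mul_continuousOn hu
      hU.isLocallyClosed
  refine ⟨huloc, hh, fun φ hφ => ?_⟩
  have hκ : ∀ n, Continuous fun z => (cutoff n (Complex.normSq (z - a)) : ℂ) := fun n =>
    Complex.continuous_ofReal.comp ((contDiff_cutoff n).continuous.comp
      (Complex.continuous_normSq.comp (by fun_prop)))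
  have hint : Integrable fun z => u z * dzbar φ z + h z * φ z :=
    (hφ.integrable_mul_dzbar huloc).add (hφ.integrable_mul hh)
  have hmain : Tendsto (fun n => ∫ z, (cutoff n (Complex.normSq (z - a)) : ℂ) *
      (u z * dzbar φ z + h z * φ z)) atTop (𝓝 (∫ z, (u z * dzbar φ z + h z * φ z))) :=
    tendsto_integral_cutoff_mul (F := fun z => z - a)
      (fun n => (hκ n).aestronglyMeasurable.mul hint.aestronglyMeasurable) hint (by
        filter_upwards [measure_eq_zero_iff_ae_notMem.1 (measure_singleton a)] with z hz hza
        exact absurd (sub_eq_zero.1 hza) hz)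
  refine tendsto_nhds_unique hmain (neg_zero (G := ℂ) ▸
    (hφ.tendsto_integral_mul_deriv_cutoff huloc hua).neg.congr fun n => ?_)
  have hmain_int : Integrable fun z => (cutoff n (Complex.normSq (z - a)) : ℂ) *
      (u z * dzbar φ z + h z * φ z) :=
    hint.bdd_mul (hκ n).aestronglyMeasurable (c := 1) (ae_of_all _ fun z => by
      rw [Complex.norm_real, Real.norm_of_nonneg (cutoff_nonneg _ _)]
      exact cutoff_le_one _ _)
  have hsplit : ∀ z, u z * φ z * (deriv (cutoff n) (Complex.normSq (z - a)) * (z - a)) =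
      (u z * dzbar (fun z => φ z * cutoff n (Complex.normSq (z - a))) z +
        h z * (φ z * cutoff n (Complex.normSq (z - a)))) -
      cutoff n (Complex.normSq (z - a)) * (u z * dzbar φ z + h z * φ z) := fun z => by
    rw [hφ.dzbar_mul_cutoff_normSq_sub]
    ring
  simp only [hsplit]
  rw [integral_sub (H.integrable (hφ.mul_cutoff_normSq_sub n a)) hmain_int,
    H.integral_eq_zero _ (hφ.mul_cutoff_normSq_sub n a), zero_sub, neg_neg]

lemma of_forall_exists (H : ∀ z ∈ U, ∃ V, IsOpen V ∧ z ∈ V ∧ WeakDbarOn u h V) :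
    WeakDbarOn u h U := by
  choose! V hVo hzV HV using H
  refine ⟨fun z hz => ?_, fun z hz => ?_, fun φ hφ => ?_⟩
  · exact ((hVo z hz).nhdsWithin_eq (hzV z hz) ▸
      (HV z hz).locallyIntegrableOn_left z (hzV z hz)).filter_mono nhdsWithin_le_nhds
  · exact ((hVo z hz).nhdsWithin_eq (hzV z hz) ▸
      (HV z hz).locallyIntegrableOn_right z (hzV z hz)).filter_mono nhdsWithin_le_nhds
  obtain ⟨t, ht⟩ := hφ.hasCompactSupport.elim_finite_subcover (fun z : U => V z)
    (fun z => hVo z z.2) fun z hz =>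
      mem_iUnion.2 ⟨⟨z, hφ.tsupport_subset hz⟩, hzV z (hφ.tsupport_subset hz)⟩
  obtain ⟨ρ, hρ⟩ := SmoothPartitionOfUnity.exists_isSubordinate (modelWithCornersSelf ℝ ℂ)
    (isClosed_tsupport φ) (fun z : t => V z) (fun z => hVo z z.1.2)
    (by simpa [iUnion_subtype] using ht)
  have hφρ : ∀ i, IsTestFunction (fun z => φ z * ρ i z) (V i) := fun i =>
    ⟨hφ.contDiff.mul (Complex.ofRealCLM.contDiff.comp (ρ i).contMDiff.contDiff),
      hφ.hasCompactSupport.mul_right, (tsupport_mul_subset_right).trans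
        ((closure_mono (Function.support_comp_subset Complex.ofReal_zero _)).trans (hρ i))⟩
  have hsum : φ = fun z => ∑ i, φ z * ρ i z := by
    funext z
    by_cases hz : z ∈ tsupport φ
    · rw [← Finset.mul_sum, ← Complex.ofReal_sum, ← finsum_eq_sum_of_fintype, ρ.sum_eq_one hz,
        Complex.ofReal_one, mul_one]
    · simp [image_eq_zero_of_notMem_tsupport hz]
  have hdzbar : ∀ z, dzbar φ z = ∑ i, dzbar (fun z => φ z * ρ i z) z := fun z => by
    conv_lhs => rw [hsum]
    exact dzbar_sum fun i _ => (hφρ i).differentiable z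
  calc ∫ z, (u z * dzbar φ z + h z * φ z)
      = ∫ z, ∑ i, (u z * dzbar (fun z => φ z * ρ i z) z + h z * (φ z * ρ i z)) := by
        congr 1 with z
        rw [Finset.sum_add_distrib, ← Finset.mul_sum, ← Finset.mul_sum, ← hdzbar, ← congrFun hsum z]
    _ = ∑ i, ∫ z, (u z * dzbar (fun z => φ z * ρ i z) z + h z * (φ z * ρ i z)) :=
        integral_finsetSum _ fun i _ => (HV i i.1.2).integrable (hφρ i)
    _ = 0 := Finset.sum_eq_zero fun i _ => (HV i i.1.2).integral_eq_zero _ (hφρ i)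

end WeakDbarOn

lemma dbarEqOn_iff_forall_weakDbarOn {m : ℕ} {u h : ℂ → Fin m → ℂ} {U : Set ℂ} :
    DbarEqOn u h U ↔ ∀ j, WeakDbarOn (fun z => u z j) (fun z => h z j) U := by
  have hloc : ∀ v : ℂ → Fin m → ℂ,
      LocallyIntegrableOn v U ↔ ∀ j, LocallyIntegrableOn (fun z => v z j) U := fun v => by
    refine ⟨fun hv j z hz => ?_, fun hv z hz => ?_⟩
    · obtain ⟨s, hs, hvs⟩ := hv z hz
      exact ⟨s, hs, hvs.eval j⟩
    · choose s hs hvs using fun j => hv j z hz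
      exact ⟨⋂ j, s j, iInter_mem.2 hs, .of_eval fun j => (hvs j).mono_set (iInter_subset s j)⟩
  have hset : ∀ {φ : ℂ → ℂ}, IsTestFunction φ U → ∀ v : ℂ → ℂ,
      ∫ z in U, v z * φ z = ∫ z, v z * φ z := fun hφ v =>
    setIntegral_eq_integral_of_forall_compl_eq_zero fun z hz => by rw [hφ.eq_zero hz, mul_zero]
  have hset' : ∀ {φ : ℂ → ℂ}, IsTestFunction φ U → ∀ v : ℂ → ℂ,
      ∫ z in U, v z * dzbar φ z = ∫ z, v z * dzbar φ z := fun hφ v =>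
    setIntegral_eq_integral_of_forall_compl_eq_zero fun z hz => by
      rw [hφ.dzbar_eq_zero hz, mul_zero]
  constructor
  · rintro ⟨hu, hh, H⟩ j
    refine ⟨(hloc u).1 hu j, (hloc h).1 hh j, fun φ hφ => ?_⟩
    rw [integral_add (hφ.integrable_mul_dzbar ((hloc u).1 hu j))
      (hφ.integrable_mul ((hloc h).1 hh j)), ← hset hφ, ← hset' hφ,
      H φ hφ.contDiff hφ.hasCompactSupport hφ.tsupport_subset j, neg_add_cancel]
  · refine fun H => ⟨(hloc u).2 fun j => (H j).locallyIntegrableOn_left,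
      (hloc h).2 fun j => (H j).locallyIntegrableOn_right, fun φ hφ hφc hφU j => ?_⟩
    have hφ' : IsTestFunction φ U := ⟨hφ, hφc, hφU⟩
    rw [hset hφ', hset' hφ', eq_neg_iff_add_eq_zero, ← integral_add
      (hφ'.integrable_mul_dzbar (H j).locallyIntegrableOn_left)
      (hφ'.integrable_mul (H j).locallyIntegrableOn_right)]
    exact (H j).integral_eq_zero φ hφ'

section CauchyKernel

variable {r : ℝ≥0∞} {a : ℂ}

lemma map_const_add_mul_volume (ha : a ≠ 0) (c : ℂ) :
    Measure.map (fun u : ℂ => c + a * u) volume = (‖a‖ₑ ^ 2)⁻¹ • (volume : Measure ℂ) := by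
  have hdet : LinearMap.det (LinearMap.mulLeft ℝ a) = ‖a‖ ^ 2 := by
    rw [← Complex.normSq_eq_norm_sq, ← Algebra.norm_complex_apply, Algebra.norm_apply]
    rfl
  have hpos : 0 < ‖a‖ ^ 2 := by positivity
  have hmul := Measure.map_linearMap_addHaar_eq_smul_addHaar (volume : Measure ℂ)
    (f := LinearMap.mulLeft ℝ a) (hdet ▸ hpos.ne')
  rw [hdet, abs_of_pos (inv_pos.2 hpos), ENNReal.ofReal_inv_of_pos hpos,
    ENNReal.ofReal_pow (norm_nonneg a), ofReal_norm] at hmul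
  calc Measure.map (fun u : ℂ => c + a * u) volume
      = Measure.map (fun u => c + u) (Measure.map (fun u => a * u) volume) :=
        (Measure.map_map (by fun_prop) (by fun_prop)).symm
    _ = (‖a‖ₑ ^ 2)⁻¹ • (volume : Measure ℂ) := by
        rw [show Measure.map (fun u => a * u) volume = _ from hmul, Measure.map_smul,
          map_add_left_eq_self]

lemma eLpNorm_eq_mul_eLpNorm_comp_affine (k : ℂ → ℂ) (ha : a ≠ 0) (c : ℂ) (r : ℝ≥0∞) :
    eLpNorm k r = ‖a‖ₑ ^ (2 / r.toReal) * eLpNorm (fun u => k (c + a * u)) r := by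
  have hemb : MeasurableEmbedding fun u : ℂ => c + a * u :=
    ((Homeomorph.mulLeft₀ a ha).trans (Homeomorph.addLeft c)).measurableEmbedding
  have h0 : ‖a‖ₑ ≠ 0 := enorm_ne_zero.2 ha
  have hcomp := hemb.eLpNorm_map_measure (g := k) (p := r) (μ := volume)
  rw [map_const_add_mul_volume ha, eLpNorm_smul_measure_of_ne_zero (by simp), smul_eq_mul] at hcomp
  have hcancel : ‖a‖ₑ ^ (2 / r.toReal) * (‖a‖ₑ ^ 2)⁻¹ ^ (1 / r).toReal = 1 := by
    rw [ENNReal.inv_rpow, ← ENNReal.rpow_natCast, ← ENNReal.rpow_mul, ENNReal.toReal_div,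
      ENNReal.toReal_one, mul_one_div, Nat.cast_ofNat]
    exact ENNReal.mul_inv_cancel (by simp [h0]) (ENNReal.rpow_ne_top_of_ne_zero h0 enorm_ne_top)
  rw [show (fun u => k (c + a * u)) = k ∘ fun u => c + a * u from rfl, ← hcomp, ← mul_assoc,
    hcancel, one_mul]

/-- Kernels homogeneous of degree `-1`, such as the Cauchy kernel, scale in this way. -/
lemma eLpNorm_eq_of_comp_affine_eq_inv_mul {k κ : ℂ → ℂ} {c : ℂ} (ha : a ≠ 0)
    (hk : ∀ u, k (c + a * u) = a⁻¹ * κ u) (r : ℝ≥0∞) :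
    eLpNorm k r = ‖a‖ₑ ^ (2 / r.toReal - 1) * eLpNorm κ r := by
  have h0 : ‖a‖ₑ ≠ 0 := enorm_ne_zero.2 ha
  rw [eLpNorm_eq_mul_eLpNorm_comp_affine k ha c, funext hk,
    show (fun u => a⁻¹ * κ u) = a⁻¹ • κ from rfl, eLpNorm_const_smul, enorm_inv ha, ← mul_assoc,
    ENNReal.rpow_sub _ _ h0 enorm_ne_top, ENNReal.rpow_one, ENNReal.div_eq_inv_mul, mul_comm _⁻¹]

lemma memLp_inv_restrict_ball (h1 : 1 ≤ r) (h2 : r < 2) (R : ℝ) :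
    MemLp (fun w : ℂ => w⁻¹) r (volume.restrict (Metric.ball 0 R)) := by
  have hrt : r ≠ ⊤ := (h2.trans_le le_top).ne
  have hr2 : r.toReal < 2 := by simpa using (ENNReal.toReal_lt_toReal hrt (by simp)).2 h2
  rw [← integrable_norm_rpow_iff (by fun_prop) (zero_lt_one.trans_le h1).ne' hrt]
  refine integrableOn_ball_of_norm_le_rpow (C := 1) (α := r.toReal) (by simp) (by simpa using hr2)
    (Eventually.of_forall fun w => ?_) (by measurability)
  rw [Real.norm_of_nonneg (by positivity), norm_inv, Real.inv_rpow (norm_nonneg _),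
    Real.rpow_neg (norm_nonneg _), one_mul]

lemma exists_memLp_norm_inv_le_norm_add_one (h1 : 1 ≤ r) (h2 : r < 2) :
    ∃ κ : ℂ → ℂ, MemLp κ r ∧ ∀ v, ‖v⁻¹‖ ≤ ‖κ v‖ + 1 := by
  refine ⟨(Metric.ball 0 1).indicator fun w => w⁻¹,
    (memLp_indicator_iff_restrict measurableSet_ball).2 (memLp_inv_restrict_ball h1 h2 1),
    fun v => ?_⟩
  by_cases hv : v ∈ Metric.ball 0 1
  · rw [indicator_of_mem hv]
    exact le_add_of_nonneg_right zero_le_one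
  · have : 1 ≤ ‖v‖ := by simpa using hv
    rw [norm_inv]
    exact (inv_le_one_of_one_le₀ this).trans (le_add_of_nonneg_left (norm_nonneg _))

lemma exists_eLpNorm_inv_sub_unitBall_le (h1 : 1 ≤ r) (h2 : r < 2) :
    ∃ C : ℝ≥0, ∀ ζ : ℂ,
      eLpNorm (fun u => (ζ - u)⁻¹) r (volume.restrict (Metric.ball 0 1)) ≤ C := by
  obtain ⟨κ, hκ, hκle⟩ := exists_memLp_norm_inv_le_norm_add_one h1 h2
  have : IsFiniteMeasure ((volume : Measure ℂ).restrict (Metric.ball 0 1)) :=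
    isFiniteMeasure_restrict.2 measure_ball_lt_top.ne
  have hone : MemLp (fun _ : ℂ => (1 : ℝ)) r (volume.restrict (Metric.ball 0 1)) := memLp_const 1
  have hfin := ENNReal.add_ne_top.2 ⟨hκ.2.ne, hone.2.ne⟩
  refine ⟨_, fun ζ => le_of_le_of_eq ?_ (ENNReal.coe_toNNReal hfin).symm⟩
  have hmp := Measure.measurePreserving_sub_left (volume : Measure ℂ) ζ
  have hκζ : MemLp (fun u => ‖κ (ζ - u)‖) r := (hκ.comp_measurePreserving hmp).norm
  have hnorm : eLpNorm (fun u => ‖κ (ζ - u)‖) r = eLpNorm κ r := by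
    rw [eLpNorm_norm]
    exact eLpNorm_comp_measurePreserving hκ.1 hmp
  calc eLpNorm (fun u => (ζ - u)⁻¹) r (volume.restrict (Metric.ball 0 1))
      ≤ eLpNorm (fun u => ‖κ (ζ - u)‖ + 1) r (volume.restrict (Metric.ball 0 1)) :=
        eLpNorm_mono_real fun u => hκle (ζ - u)
    _ ≤ eLpNorm (fun u => ‖κ (ζ - u)‖) r (volume.restrict (Metric.ball 0 1)) + _ :=
        eLpNorm_add_le hκζ.1.restrict hone.1 h1
    _ ≤ _ := by
        rw [← hnorm]
        gcongr
        exact Measure.restrict_le_self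

lemma exists_eLpNorm_inv_sub_ball_le (h1 : 1 ≤ r) (h2 : r < 2) :
    ∃ C : ℝ≥0, ∀ (z z₀ : ℂ) (δ : ℝ), 0 < δ →
      eLpNorm (fun w => (z - w)⁻¹) r (volume.restrict (Metric.ball z₀ δ)) ≤
        C * ENNReal.ofReal (δ ^ (2 / r.toReal - 1)) := by
  obtain ⟨C, hC⟩ := exists_eLpNorm_inv_sub_unitBall_le h1 h2
  refine ⟨C, fun z z₀ δ hδ => ?_⟩
  have hδ0 : (δ : ℂ) ≠ 0 := Complex.ofReal_ne_zero.2 hδ.ne'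
  have hball : ∀ u, z₀ + δ * u ∈ Metric.ball z₀ δ ↔ u ∈ Metric.ball (0 : ℂ) 1 := fun u => by
    rw [mem_ball_iff_norm, add_sub_cancel_left, norm_mul, Complex.norm_of_nonneg hδ.le,
      mem_ball_zero_iff, mul_lt_iff_lt_one_right hδ]
  have hscale : ∀ u, (Metric.ball z₀ δ).indicator (fun w => (z - w)⁻¹) (z₀ + δ * u) =
      (δ : ℂ)⁻¹ * (Metric.ball 0 1).indicator (fun u => ((z - z₀) / δ - u)⁻¹) u := fun u => by
    by_cases hu : u ∈ Metric.ball (0 : ℂ) 1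
    · rw [indicator_of_mem ((hball u).2 hu), indicator_of_mem hu, ← mul_inv, mul_sub,
        mul_div_cancel₀ _ hδ0, sub_sub]
    · rw [indicator_of_notMem (mt (hball u).1 hu), indicator_of_notMem hu, mul_zero]
  rw [← eLpNorm_indicator_eq_eLpNorm_restrict measurableSet_ball,
    eLpNorm_eq_of_comp_affine_eq_inv_mul hδ0 hscale, ← ofReal_norm,
    Complex.norm_of_nonneg hδ.le, ENNReal.ofReal_rpow_of_pos hδ, mul_comm,
    eLpNorm_indicator_eq_eLpNorm_restrict measurableSet_ball]
  gcongr
  exact hC _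

lemma norm_inv_sub_inv_one_sub_le {u : ℂ} (hu : 2 ≤ ‖u‖) :
    ‖(0 - u)⁻¹ - (1 - u)⁻¹‖ ≤ 5 * (1 + ‖u‖) ^ (-2 : ℝ) := by
  have hu0 : u ≠ 0 := norm_pos_iff.1 (by linarith)
  have hu1 : ‖u‖ / 2 ≤ ‖1 - u‖ := by
    have := norm_sub_norm_le u 1
    rw [norm_sub_rev, norm_one] at this
    linarith
  have hu1' : 1 - u ≠ 0 := norm_pos_iff.1 (by linarith)
  have hprod : (0 - u)⁻¹ - (1 - u)⁻¹ = -(u * (1 - u))⁻¹ := by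
    rw [zero_sub]
    field_simp
    ring
  rw [hprod, norm_neg, norm_inv, norm_mul, Real.rpow_neg (by positivity), ← div_eq_mul_inv,
    inv_eq_one_div, div_le_div_iff₀ (by nlinarith) (by positivity), Real.rpow_two]
  nlinarith

lemma memLp_inv_sub_inv_one_sub (h1 : 1 < r) (h2 : r < 2) :
    MemLp (fun u : ℂ => (0 - u)⁻¹ - (1 - u)⁻¹) r := by
  have hrt : r ≠ ⊤ := (h2.trans_le le_top).ne
  have hr1 : 1 < r.toReal := by simpa using (ENNReal.toReal_lt_toReal (by simp) hrt).2 h1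
  obtain ⟨C, hC⟩ := exists_eLpNorm_inv_sub_ball_le h1.le h2
  have hnear : MemLp (fun u : ℂ => (0 - u)⁻¹ - (1 - u)⁻¹) r
      (volume.restrict (Metric.ball 0 2)) := by
    have hkernel : ∀ z : ℂ, MemLp (fun u => (z - u)⁻¹) r (volume.restrict (Metric.ball 0 2)) :=
      fun z => ⟨by fun_prop, (hC z 0 2 two_pos).trans_lt
        (ENNReal.mul_lt_top ENNReal.coe_lt_top ENNReal.ofReal_lt_top)⟩
    exact (hkernel 0).sub (hkernel 1)
  have hdecay : MemLp (fun u : ℂ => 5 * (1 + ‖u‖) ^ (-2 : ℝ)) r := by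
    refine MemLp.const_mul ?_ 5
    rw [← integrable_norm_rpow_iff (by measurability) (zero_lt_one.trans h1).ne' hrt]
    refine (integrable_one_add_norm (E := ℂ) (μ := volume) (r := 2 * r.toReal)
      (by simp; linarith)).congr (Eventually.of_forall fun u => ?_)
    simp only
    rw [Real.norm_of_nonneg (by positivity), ← Real.rpow_mul (by positivity), neg_mul]
  have hfar : MemLp (fun u : ℂ => (0 - u)⁻¹ - (1 - u)⁻¹) r
      (volume.restrict (Metric.ball 0 2)ᶜ) :=
    (hdecay.restrict _).mono' (by fun_prop) (ae_restrict_of_forall_mem measurableSet_ball.compl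
      fun u hu => norm_inv_sub_inv_one_sub_le (by simpa using hu))
  rw [← indicator_self_add_compl (Metric.ball 0 2) (fun u : ℂ => (0 - u)⁻¹ - (1 - u)⁻¹)]
  exact ((memLp_indicator_iff_restrict measurableSet_ball).2 hnear).add
    ((memLp_indicator_iff_restrict measurableSet_ball.compl).2 hfar)

lemma exists_eLpNorm_inv_sub_sub_inv_sub_le (h1 : 1 < r) (h2 : r < 2) :
    ∃ C : ℝ≥0, ∀ z₁ z₂ : ℂ, eLpNorm (fun w => (z₁ - w)⁻¹ - (z₂ - w)⁻¹) r ≤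
      C * edist z₁ z₂ ^ (2 / r.toReal - 1) := by
  have hκ := memLp_inv_sub_inv_one_sub h1 h2
  refine ⟨(eLpNorm (fun u : ℂ => (0 - u)⁻¹ - (1 - u)⁻¹) r).toNNReal, fun z₁ z₂ => ?_⟩
  rcases eq_or_ne z₁ z₂ with rfl | hz
  · simp
  have hscale : ∀ u, (z₁ - (z₁ + (z₂ - z₁) * u))⁻¹ - (z₂ - (z₁ + (z₂ - z₁) * u))⁻¹ =
      (z₂ - z₁)⁻¹ * ((0 - u)⁻¹ - (1 - u)⁻¹) := fun u => by
    rw [mul_sub, ← mul_inv, ← mul_inv]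
    ring
  rw [eLpNorm_eq_of_comp_affine_eq_inv_mul (sub_ne_zero.2 hz.symm) hscale, edist_comm,
    edist_eq_enorm_sub, ENNReal.coe_toNNReal hκ.2.ne, mul_comm]

end CauchyKernel

section CauchyTransform

variable {p : ℝ≥0∞} {b b' : ℂ → ℂ} {z₀ : ℂ} {δ : ℝ}

lemma exists_holderConjugate_lt_two (hp : 2 < p) :
    ∃ r : ℝ≥0∞, ENNReal.HolderConjugate p r ∧ 1 ≤ r ∧ r < 2 ∧ (p ≠ ⊤ → 1 < r) ∧
      2 / r.toReal - 1 = 1 - 2 / p.toReal := by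
  have hinv : p⁻¹ < 2⁻¹ := ENNReal.inv_lt_inv.2 hp
  have hinv1 : p⁻¹ < 1 := hinv.trans (by simp)
  refine ⟨(1 - p⁻¹)⁻¹, ⟨?_⟩, ?_, ?_, fun hpt => ?_, ?_⟩
  · rw [inv_inv, inv_one]
    exact add_tsub_cancel_of_le hinv1.le
  · rw [ENNReal.one_le_inv]
    exact tsub_le_self
  · rw [ENNReal.inv_lt_iff_inv_lt, lt_tsub_iff_right, ← ENNReal.inv_two_add_inv_two]
    exact ENNReal.add_lt_add_left (by simp) hinv
  · rw [ENNReal.one_lt_inv]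
    exact ENNReal.sub_lt_self ENNReal.one_ne_top one_ne_zero (by simpa using hpt)
  · rw [ENNReal.toReal_inv, ENNReal.toReal_sub_of_le hinv1.le ENNReal.one_ne_top,
      ENNReal.toReal_inv, ENNReal.toReal_one, div_inv_eq_mul]
    ring

lemma one_sub_two_div_toReal_pos (hp : 2 < p) : 0 < 1 - 2 / p.toReal := by
  rcases eq_or_ne p ⊤ with rfl | hpt
  · simp
  · have hp2 : 2 < p.toReal := by simpa using (ENNReal.toReal_lt_toReal (by simp) hpt).2 hp
    rwa [sub_pos, div_lt_one (by linarith)]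

lemma exists_finite_exponent_le (hp : 2 < p) : ∃ q : ℝ≥0∞, 2 < q ∧ q ≠ ⊤ ∧ q ≤ p := by
  obtain ⟨q, h1, h2⟩ := exists_between hp
  exact ⟨q, h1, (h2.trans_le le_top).ne, h2.le⟩

lemma memLp_of_le_of_support_subset_ball {q : ℝ≥0∞} (hb : MemLp b p) (hqp : q ≤ p)
    (hbs : Function.support b ⊆ Metric.ball z₀ δ) : MemLp b q :=
  hb.mono_exponent_of_measure_support_ne_top
    (fun _ hx => Function.notMem_support.1 fun h => hx (hbs h)) measure_ball_lt_top.ne hqp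

lemma enorm_integral_mul_le {r : ℝ≥0∞} [ENNReal.HolderConjugate p r] {μ : Measure ℂ} {k : ℂ → ℂ}
    (hb : AEStronglyMeasurable b μ) (hk : AEStronglyMeasurable k μ) :
    ‖∫ w, b w * k w ∂μ‖ₑ ≤ eLpNorm b p μ * eLpNorm k r μ := by
  calc ‖∫ w, b w * k w ∂μ‖ₑ
      ≤ ∫⁻ w, ‖(b • k) w‖ₑ ∂μ := enorm_integral_le_lintegral_enorm _
    _ = eLpNorm (b • k) 1 μ := eLpNorm_one_eq_lintegral_enorm.symm
    _ ≤ eLpNorm b p μ * eLpNorm k r μ := eLpNorm_smul_le_mul_eLpNorm hk hb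

/-- The Cauchy transform `b ↦ (πz)⁻¹ ∗ b`, a right inverse of `∂/∂z̄`. -/
noncomputable def cauchyTransform (b : ℂ → ℂ) (z : ℂ) : ℂ :=
  (Real.pi : ℂ)⁻¹ * ∫ w, b w * (z - w)⁻¹

lemma enorm_pi_inv_mul_le (x : ℂ) : ‖(Real.pi : ℂ)⁻¹ * x‖ₑ ≤ ‖x‖ₑ := by
  rw [enorm_le_iff_norm_le, norm_mul, norm_inv, Complex.norm_of_nonneg Real.pi_pos.le]
  exact mul_le_of_le_one_left (norm_nonneg x)
    (inv_le_one_of_one_le₀ (by linarith [Real.pi_gt_three]))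

lemma integrable_mul_inv_sub (hp : 2 < p) (hb : MemLp b p) (hδ : 0 < δ)
    (hbs : Function.support b ⊆ Metric.ball z₀ δ) (z : ℂ) :
    Integrable fun w => b w * (z - w)⁻¹ := by
  obtain ⟨r, hpr, h1, h2, -, -⟩ := exists_holderConjugate_lt_two hp
  obtain ⟨C, hC⟩ := exists_eLpNorm_inv_sub_ball_le h1 h2
  have hk : MemLp (fun w => (z - w)⁻¹) r (volume.restrict (Metric.ball z₀ δ)) :=
    ⟨by fun_prop, (hC z z₀ δ hδ).trans_lt
      (ENNReal.mul_lt_top ENNReal.coe_lt_top ENNReal.ofReal_lt_top)⟩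
  have hint : IntegrableOn (fun w => b w * (z - w)⁻¹) (Metric.ball z₀ δ) :=
    memLp_one_iff_integrable.1 (hk.smul (hb.restrict _))
  exact (integrableOn_iff_integrable_of_support_subset
    ((Function.support_mul_subset_left _ _).trans hbs)).1 hint

lemma cauchyTransform_sub (hp : 2 < p) (hb : MemLp b p) (hb' : MemLp b' p) (hδ : 0 < δ)
    (hbs : Function.support b ⊆ Metric.ball z₀ δ) (hbs' : Function.support b' ⊆ Metric.ball z₀ δ)
    (z : ℂ) :
    cauchyTransform (b - b') z = cauchyTransform b z - cauchyTransform b' z := by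
  simp only [cauchyTransform, ← mul_sub, Pi.sub_apply, sub_mul]
  rw [integral_sub (integrable_mul_inv_sub hp hb hδ hbs z)
    (integrable_mul_inv_sub hp hb' hδ hbs' z)]

lemma exists_norm_cauchyTransform_le (hp : 2 < p) :
    ∃ C : ℝ≥0, ∀ (b : ℂ → ℂ) (z₀ : ℂ) (δ : ℝ) (N : ℝ≥0), 0 < δ → AEStronglyMeasurable b →
      Function.support b ⊆ Metric.ball z₀ δ → eLpNorm b p ≤ N →
      ∀ z, ‖cauchyTransform b z‖ ≤ C * δ ^ (1 - 2 / p.toReal) * N := by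
  obtain ⟨r, hpr, h1, h2, -, hexp⟩ := exists_holderConjugate_lt_two hp
  obtain ⟨C, hC⟩ := exists_eLpNorm_inv_sub_ball_le h1 h2
  rw [hexp] at hC
  refine ⟨C, fun b z₀ δ N hδ hbm hbs hbN z => ?_⟩
  have hset : ∫ w, b w * (z - w)⁻¹ = ∫ w in Metric.ball z₀ δ, b w * (z - w)⁻¹ :=
    (setIntegral_eq_integral_of_forall_compl_eq_zero fun w hw => by
      rw [Function.notMem_support.1 fun h => hw (hbs h), zero_mul]).symm
  have henorm := calc ‖cauchyTransform b z‖ₑ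
      ≤ ‖∫ w in Metric.ball z₀ δ, b w * (z - w)⁻¹‖ₑ := hset ▸ enorm_pi_inv_mul_le _
    _ ≤ eLpNorm b p (volume.restrict (Metric.ball z₀ δ)) *
          eLpNorm (fun w => (z - w)⁻¹) r (volume.restrict (Metric.ball z₀ δ)) :=
        enorm_integral_mul_le hbm.restrict (by fun_prop)
    _ ≤ N * (C * ENNReal.ofReal (δ ^ (1 - 2 / p.toReal))) := by
        gcongr
        · exact (eLpNorm_mono_measure b Measure.restrict_le_self).trans hbN
        · exact hC z z₀ δ hδ
  rw [← ofReal_norm, ← ENNReal.ofReal_coe_nnreal, ← ENNReal.ofReal_coe_nnreal (p := C),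
    ← ENNReal.ofReal_mul C.coe_nonneg, ← ENNReal.ofReal_mul N.coe_nonneg,
    ENNReal.ofReal_le_ofReal_iff (by positivity), mul_comm] at henorm
  exact henorm

lemma exists_edist_cauchyTransform_le (hp : 2 < p) (hpt : p ≠ ⊤) (hb : MemLp b p) (hδ : 0 < δ)
    (hbs : Function.support b ⊆ Metric.ball z₀ δ) :
    ∃ C : ℝ≥0, ∀ z₁ z₂, edist (cauchyTransform b z₁) (cauchyTransform b z₂) ≤
      eLpNorm b p * (C * edist z₁ z₂ ^ (1 - 2 / p.toReal)) := by
  obtain ⟨r, hpr, -, h2, h1, hexp⟩ := exists_holderConjugate_lt_two hp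
  obtain ⟨C, hC⟩ := exists_eLpNorm_inv_sub_sub_inv_sub_le (h1 hpt) h2
  refine ⟨C, fun z₁ z₂ => ?_⟩
  have hi := integrable_mul_inv_sub hp hb hδ hbs
  have hrepr : edist (cauchyTransform b z₁) (cauchyTransform b z₂) ≤
      ‖∫ w, b w * ((z₁ - w)⁻¹ - (z₂ - w)⁻¹)‖ₑ := by
    simp only [edist_eq_enorm_sub, cauchyTransform, ← mul_sub, ← integral_sub (hi z₁) (hi z₂)]
    exact enorm_pi_inv_mul_le _
  have hholder := enorm_integral_mul_le (p := p) (r := r) hb.1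
    (k := fun w => (z₁ - w)⁻¹ - (z₂ - w)⁻¹) (by fun_prop)
  exact (hrepr.trans hholder).trans (mul_le_mul_right (hexp ▸ hC z₁ z₂) _)

lemma exists_holderWith_cauchyTransform (hp : 2 < p) (hpt : p ≠ ⊤) (hb : MemLp b p) (hδ : 0 < δ)
    (hbs : Function.support b ⊆ Metric.ball z₀ δ) :
    ∃ C : ℝ≥0, HolderWith C (1 - 2 / p.toReal).toNNReal (cauchyTransform b) := by
  obtain ⟨C, hC⟩ := exists_edist_cauchyTransform_le hp hpt hb hδ hbs
  refine ⟨(eLpNorm b p).toNNReal * C, fun z₁ z₂ => ?_⟩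
  rw [ENNReal.coe_mul, ENNReal.coe_toNNReal hb.2.ne, mul_assoc,
    Real.coe_toNNReal _ (one_sub_two_div_toReal_pos hp).le]
  exact hC z₁ z₂

lemma continuous_cauchyTransform (hp : 2 < p) (hb : MemLp b p) (hδ : 0 < δ)
    (hbs : Function.support b ⊆ Metric.ball z₀ δ) : Continuous (cauchyTransform b) := by
  obtain ⟨q, hq, hqt, hqp⟩ := exists_finite_exponent_le hp
  obtain ⟨C, hC⟩ := exists_holderWith_cauchyTransform hq hqt
    (memLp_of_le_of_support_subset_ball hb hqp hbs) hδ hbs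
  exact hC.continuous (Real.toNNReal_pos.2 (one_sub_two_div_toReal_pos hq))

lemma cauchyTransform_eq_convolution (b : ℂ → ℂ) :
    cauchyTransform b = fun z => ∫ t, (Real.pi : ℂ)⁻¹ * t⁻¹ * b (z - t) := by
  ext z
  rw [cauchyTransform, ← integral_sub_left_eq_self _ volume z, ← integral_const_mul]
  congr 1 with t
  rw [sub_sub_cancel]
  ring

lemma locallyIntegrable_pi_inv_mul_inv :
    LocallyIntegrable fun t : ℂ => (Real.pi : ℂ)⁻¹ * t⁻¹ :=
  locallyIntegrable_inv.smul (Real.pi : ℂ)⁻¹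

lemma IsTestFunction.contDiff_cauchyTransform {U : Set ℂ} (hb : IsTestFunction b U) :
    ContDiff ℝ ∞ (cauchyTransform b) := by
  rw [cauchyTransform_eq_convolution]
  exact hb.hasCompactSupport.contDiff_convolution_right (ContinuousLinearMap.mul ℝ ℂ)
    locallyIntegrable_pi_inv_mul_inv hb.contDiff

lemma IsTestFunction.dzbar_cauchyTransform {U : Set ℂ} (hb : IsTestFunction b U) (z : ℂ) :
    dzbar (cauchyTransform b) z = b z := by
  have hpompeiu := ((hb.comp_const_sub z).mono (subset_univ _)).integral_inv_mul_dzbar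
  simp only [dzbar_comp_const_sub, sub_zero, mul_neg, integral_neg, neg_inj, neg_mul] at hpompeiu
  rw [cauchyTransform_eq_convolution, dzbar_convolution locallyIntegrable_pi_inv_mul_inv
    (hb.contDiff.of_le (by simp)) hb.hasCompactSupport]
  simp only [mul_assoc, integral_const_mul, hpompeiu]
  exact inv_mul_cancel_left₀ (Complex.ofReal_ne_zero.2 Real.pi_ne_zero) _

lemma exists_isTestFunction_eLpNorm_sub_le (hp : 1 ≤ p) (hpt : p ≠ ⊤) (hb : MemLp b p)
    (hδ : 0 < δ) (hbs : Function.support b ⊆ Metric.ball z₀ δ) {ε : ℝ} (hε : 0 < ε) :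
    ∃ b', IsTestFunction b' (Metric.ball z₀ (2 * δ)) ∧
      eLpNorm (b - b') p ≤ ENNReal.ofReal ε := by
  obtain ⟨g, -, hg, hbg⟩ := hb.exist_eLpNorm_sub_le hpt hp hε
  let ρ : ContDiffBump z₀ := ⟨δ, 3 / 2 * δ, hδ, by linarith⟩
  have hρ : IsTestFunction (fun w => (ρ w : ℂ)) (Metric.ball z₀ (2 * δ)) :=
    .ofReal ρ.contDiff ρ.hasCompactSupport
      (ρ.tsupport_eq ▸ Metric.closedBall_subset_ball (by change 3 / 2 * δ < 2 * δ; linarith))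
  refine ⟨_, hρ.mul_right hg, (eLpNorm_mono fun w => ?_).trans hbg⟩
  by_cases hw : w ∈ Metric.ball z₀ δ
  · have : ρ w = 1 := ρ.one_of_mem_closedBall (Metric.ball_subset_closedBall hw)
    simp [this]
  · simp only [Pi.sub_apply, Function.notMem_support.1 fun h => hw (hbs h), zero_sub, norm_neg,
      norm_mul, Complex.norm_of_nonneg ρ.nonneg]
    exact mul_le_of_le_one_left (norm_nonneg _) ρ.le_one

end CauchyTransform

section ProductRule

variable {p : ℝ≥0∞} {u h v w b : ℂ → ℂ} {z₀ : ℂ} {δ : ℝ} {U : Set ℂ}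

lemma integrable_mul_cauchyTransform (hp : 2 < p) (hw : Integrable w) (hb : MemLp b p)
    (hδ : 0 < δ) (hbs : Function.support b ⊆ Metric.ball z₀ δ) :
    Integrable fun z => w z * cauchyTransform b z := by
  obtain ⟨C, hC⟩ := exists_norm_cauchyTransform_le hp
  exact hw.mul_bdd (continuous_cauchyTransform hp hb hδ hbs).aestronglyMeasurable
    (Eventually.of_forall
      (hC b z₀ δ _ hδ hb.1 hbs (ENNReal.coe_toNNReal hb.2.ne).ge))

lemma integrable_mul_cauchyTransform_add {r : ℝ≥0∞} [ENNReal.HolderConjugate p r] (hp : 2 < p)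
    (hw : Integrable w) (hv : MemLp v r) (hb : MemLp b p) (hδ : 0 < δ)
    (hbs : Function.support b ⊆ Metric.ball z₀ δ) :
    Integrable fun z => w z * cauchyTransform b z + b z * v z :=
  (integrable_mul_cauchyTransform hp hw hb hδ hbs).add (memLp_one_iff_integrable.1 (hv.smul hb))

lemma exists_norm_integral_mul_cauchyTransform_add_le {r : ℝ≥0∞} [ENNReal.HolderConjugate p r]
    (hp : 2 < p) (hw : Integrable w) (hv : MemLp v r) (hδ : 0 < δ) (z₀ : ℂ) :
    ∃ K : ℝ, ∀ (b : ℂ → ℂ) (N : ℝ≥0), MemLp b p →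
      Function.support b ⊆ Metric.ball z₀ δ → eLpNorm b p ≤ N →
      ‖∫ z, (w z * cauchyTransform b z + b z * v z)‖ ≤ K * N := by
  obtain ⟨C, hC⟩ := exists_norm_cauchyTransform_le hp
  refine ⟨(∫ z, ‖w z‖) * (C * δ ^ (1 - 2 / p.toReal)) + (eLpNorm v r).toReal,
    fun b N hb hbs hbN => ?_⟩
  have hTb : ‖∫ z, w z * cauchyTransform b z‖ ≤
      (∫ z, ‖w z‖) * (C * δ ^ (1 - 2 / p.toReal) * N) := by
    rw [← integral_mul_const]
    refine norm_integral_le_of_norm_le (hw.norm.mul_const _) (Eventually.of_forall fun z => ?_)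
    rw [norm_mul]
    exact mul_le_mul_of_nonneg_left (hC b z₀ δ N hδ hb.1 hbs hbN z) (norm_nonneg _)
  have hbv : ‖∫ z, b z * v z‖ ≤ N * (eLpNorm v r).toReal := by
    have hholder := enorm_integral_mul_le (p := p) (r := r) hb.1 hv.1
    have hfin : (N : ℝ≥0∞) * eLpNorm v r ≠ ⊤ := ENNReal.mul_ne_top ENNReal.coe_ne_top hv.2.ne
    have hmono : eLpNorm b p * eLpNorm v r ≤ N * eLpNorm v r := by gcongr
    rw [← ENNReal.coe_toReal N, ← ENNReal.toReal_mul, ← toReal_enorm]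
    exact ENNReal.toReal_mono hfin (hholder.trans hmono)
  have hbvi : Integrable fun z => b z * v z := memLp_one_iff_integrable.1 (hv.smul hb)
  rw [integral_add (integrable_mul_cauchyTransform hp hw hb hδ hbs) hbvi]
  linarith [norm_add_le (∫ z, w z * cauchyTransform b z) (∫ z, b z * v z)]

lemma integral_mul_cauchyTransform_add_eq_zero {r : ℝ≥0∞} [ENNReal.HolderConjugate p r]
    (hp : 2 < p) (hpt : p ≠ ⊤) (hw : Integrable w) (hv : MemLp v r)
    (hwv : ∀ b V, IsTestFunction b V → ∫ z, (w z * cauchyTransform b z + b z * v z) = 0)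
    (hb : MemLp b p) (hδ : 0 < δ) (hbs : Function.support b ⊆ Metric.ball z₀ δ) :
    ∫ z, (w z * cauchyTransform b z + b z * v z) = 0 := by
  have hδ2 : 0 < 2 * δ := by linarith
  have hbs2 := hbs.trans (Metric.ball_subset_ball (by linarith : δ ≤ 2 * δ))
  obtain ⟨K, hKb⟩ := exists_norm_integral_mul_cauchyTransform_add_le hp hw hv hδ2 z₀
  have hsmall : ∀ ε : ℝ≥0, 0 < ε →
      ‖∫ z, (w z * cauchyTransform b z + b z * v z)‖ ≤ K * ε := fun ε hε => by
    obtain ⟨b', hb', hbb'⟩ := exists_isTestFunction_eLpNorm_sub_le (one_le_two.trans hp.le) hpt hb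
      hδ hbs (NNReal.coe_pos.2 hε)
    have hb'p : MemLp b' p := hb'.contDiff.continuous.memLp_of_hasCompactSupport
      hb'.hasCompactSupport
    have hb's := (subset_tsupport b').trans hb'.tsupport_subset
    have hdiff : ∫ z, (w z * cauchyTransform b z + b z * v z) =
        ∫ z, (w z * cauchyTransform (b - b') z + (b - b') z * v z) := by
      rw [← sub_zero (∫ z, _), ← hwv b' _ hb', ← integral_sub
        (integrable_mul_cauchyTransform_add hp hw hv hb hδ2 hbs2)
        (integrable_mul_cauchyTransform_add hp hw hv hb'p hδ2 hb's)]
      congr 1 with z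
      rw [cauchyTransform_sub hp hb hb'p hδ2 hbs2 hb's, Pi.sub_apply]
      ring
    rw [hdiff]
    exact hKb _ ε (hb.sub hb'p) ((Function.support_sub b b').trans (union_subset hbs2 hb's))
      (by rwa [ENNReal.ofReal_coe_nnreal] at hbb')
  have hlim : Tendsto (fun ε : ℝ≥0 => K * ε) (𝓝[>] 0) (𝓝 0) := by
    have : Continuous fun ε : ℝ≥0 => K * ε := by fun_prop
    simpa using (this.tendsto 0).mono_left nhdsWithin_le_nhds
  exact norm_le_zero_iff.1
    (ge_of_tendsto hlim (eventually_nhdsWithin_of_forall fun ε hε => hsmall ε hε))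

lemma WeakDbarOn.mul_cauchyTransform (H : WeakDbarOn u h U) (hU : IsOpen U)
    (hu : ContinuousOn u U) (hp : 2 < p) (hb : MemLp b p) (hδ : 0 < δ)
    (hbs : Function.support b ⊆ Metric.ball z₀ δ) :
    WeakDbarOn (fun z => u z * cauchyTransform b z)
      (fun z => h z * cauchyTransform b z + b z * u z) U := by
  have hT := continuous_cauchyTransform hp hb hδ hbs
  obtain ⟨q, hq, hqt, hqp⟩ := exists_finite_exponent_le hp
  replace hb := memLp_of_le_of_support_subset_ball hb hqp hbs
  obtain ⟨r, hqr, -⟩ := exists_holderConjugate_lt_two hq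
  have hq1 : 1 ≤ q := one_le_two.trans hq.le
  refine ⟨(hu.mul hT.continuousOn).locallyIntegrableOn hU.measurableSet,
    (H.locallyIntegrableOn_right.mul_continuousOn hT.continuousOn hU.isLocallyClosed).add
      ((hb.locallyIntegrable hq1).locallyIntegrableOn U |>.mul_continuousOn hu hU.isLocallyClosed),
    fun φ hφ => ?_⟩
  have hw := H.integrable hφ
  have hv : MemLp (fun z => u z * φ z) r :=
    (ContinuousOn.continuous_of_tsupport_subset (hu.mul hφ.contDiff.continuous.continuousOn) hU
      ((tsupport_mul_subset_right).trans hφ.tsupport_subset)).memLp_of_hasCompactSupport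
      hφ.hasCompactSupport.mul_left
  have htest : ∀ b V, IsTestFunction b V →
      ∫ z, ((u z * dzbar φ z + h z * φ z) * cauchyTransform b z + b z * (u z * φ z)) = 0 := by
    intro b V hbV
    have hTb := hbV.contDiff_cauchyTransform
    rw [← H.integral_eq_zero _ (hφ.mul_right hTb)]
    congr 1 with z
    rw [dzbar_mul (hφ.differentiable z) (hTb.differentiable (by simp) z),
      hbV.dzbar_cauchyTransform]
    ring
  rw [← integral_mul_cauchyTransform_add_eq_zero hq hqt hw hv htest hb hδ hbs]
  congr 1 with z
  ring

end ProductRule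

section Gauge

open BoundedContinuousFunction

lemma exists_map_add_eq_self {E : Type*} [NormedAddCommGroup E] [CompleteSpace E] (L : E →+ E)
    {κ : ℝ} (hκ : κ ∈ Icc 0 (1 / 2)) (hL : ∀ v, ‖L v‖ ≤ κ * ‖v‖) (e : E) :
    ∃ v, L (e + v) = v ∧ ‖v‖ ≤ 2 * κ * ‖e‖ := by
  have hcontr : ContractingWith (1 / 2) fun v => L (e + v) := by
    refine ⟨NNReal.half_lt_self one_ne_zero, LipschitzWith.of_dist_le_mul fun v w => ?_⟩
    rw [dist_eq_norm, dist_eq_norm, ← map_sub, add_sub_add_left_eq_sub]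
    refine (hL _).trans (mul_le_mul_of_nonneg_right ?_ (norm_nonneg _))
    simpa using hκ.2
  have hfix := hcontr.fixedPoint_isFixedPt
  set v := hcontr.fixedPoint
  refine ⟨v, hfix, ?_⟩
  have hv : ‖v‖ ≤ κ * (‖e‖ + ‖v‖) := calc
    ‖v‖ = ‖L (e + v)‖ := congrArg norm hfix.symm
    _ ≤ κ * ‖e + v‖ := hL _
    _ ≤ κ * (‖e‖ + ‖v‖) := mul_le_mul_of_nonneg_left (norm_add_le e v) hκ.1
  nlinarith [mul_le_mul_of_nonneg_right hκ.2 (norm_nonneg v)]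

variable {ι : Type*} [Fintype ι] {p : ℝ≥0∞} {B : ℂ → Matrix ι ι ℂ} {z₀ : ℂ} {δ : ℝ} {M : ℝ≥0}

lemma norm_apply_le_norm (v : ℂ →ᵇ ι → ℂ) (w : ℂ) (k : ι) : ‖v w k‖ ≤ ‖v‖ :=
  (norm_le_pi_norm (v w) k).trans (v.norm_coe_le_norm w)

lemma memLp_vecMul (hB : ∀ j k, MemLp (fun w => B w j k) p) (v : ℂ →ᵇ ι → ℂ) (k : ι) :
    MemLp (fun w => (v w ᵥ* B w) k) p :=
  memLp_finsetSum _ fun l _ => (hB l k).mul <| memLp_top_of_bound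
    ((continuous_apply l).comp v.continuous).aestronglyMeasurable ‖v‖
    (Eventually.of_forall fun w => norm_apply_le_norm v w l)

lemma eLpNorm_vecMul_le (hp : 1 ≤ p) (hB : ∀ j k, AEStronglyMeasurable fun w => B w j k)
    (hM : ∀ j k, eLpNorm (fun w => B w j k) p ≤ M) (v : ℂ →ᵇ ι → ℂ) (k : ι) :
    eLpNorm (fun w => (v w ᵥ* B w) k) p ≤ (Fintype.card ι * (‖v‖₊ * M) : ℝ≥0) := by
  have hmeas : ∀ l ∈ Finset.univ, AEStronglyMeasurable fun w => v w l * B w l k := fun l _ =>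
    ((continuous_apply l).comp v.continuous).aestronglyMeasurable.mul (hB l k)
  have hterm : ∀ l, eLpNorm (fun w => v w l * B w l k) p ≤ (‖v‖₊ * M : ℝ≥0) := fun l => by
    refine (eLpNorm_le_nnreal_smul_eLpNorm_of_ae_le_mul (c := ‖v‖₊) (g := fun w => B w l k)
      (Eventually.of_forall fun w => ?_) p).trans ?_
    · rw [nnnorm_mul]
      exact mul_le_mul_left (α := ℝ≥0) (norm_apply_le_norm v w l) _
    · rw [ENNReal.coe_mul]
      exact mul_le_mul_right (hM l k) _
  have hsum : (fun w => (v w ᵥ* B w) k) = ∑ l, fun w => v w l * B w l k := by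
    ext w
    rw [Finset.sum_apply, Matrix.vecMul, dotProduct]
  rw [hsum]
  refine (eLpNorm_sum_le hmeas hp).trans ((Finset.sum_le_sum fun l _ => hterm l).trans ?_)
  rw [Finset.sum_const, Finset.card_univ, nsmul_eq_mul]
  norm_cast

lemma support_vecMul_subset (hBs : Function.support B ⊆ Metric.ball z₀ δ) (v : ℂ → ι → ℂ)
    (k : ι) : Function.support (fun w => (v w ᵥ* B w) k) ⊆ Metric.ball z₀ δ :=
  Subset.trans (fun w hw (hBw : B w = 0) => hw (by simp [hBw])) hBs

lemma exists_addMonoidHom_cauchyTransform_vecMul (ι : Type*) [Fintype ι] (hp : 2 < p) :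
    ∃ C : ℝ≥0, ∀ (B : ℂ → Matrix ι ι ℂ) (z₀ : ℂ) (δ : ℝ) (M : ℝ≥0), 0 < δ →
      (∀ j k, MemLp (fun w => B w j k) p) → (∀ j k, eLpNorm (fun w => B w j k) p ≤ M) →
      Function.support B ⊆ Metric.ball z₀ δ →
      ∃ L : (ℂ →ᵇ ι → ℂ) →+ (ℂ →ᵇ ι → ℂ),
        (∀ v z k, L v z k = cauchyTransform (fun w => (v w ᵥ* B w) k) z) ∧
        ∀ v, ‖L v‖ ≤ C * (M * δ ^ (1 - 2 / p.toReal)) * ‖v‖ := by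
  obtain ⟨C, hC⟩ := exists_norm_cauchyTransform_le hp
  refine ⟨C * Fintype.card ι, fun B z₀ δ M hδ hB hBM hBs => ?_⟩
  have hcont : ∀ (v : ℂ →ᵇ ι → ℂ) k, Continuous (cauchyTransform fun w => (v w ᵥ* B w) k) :=
    fun v k =>
      continuous_cauchyTransform hp (memLp_vecMul hB v k) hδ (support_vecMul_subset hBs v k)
  have hbound : ∀ (v : ℂ →ᵇ ι → ℂ) z,
      ‖fun k => cauchyTransform (fun w => (v w ᵥ* B w) k) z‖ ≤
        (C * Fintype.card ι) * (M * δ ^ (1 - 2 / p.toReal)) * ‖v‖ := fun v z => by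
    refine (pi_norm_le_iff_of_nonneg (by positivity)).2 fun k => ?_
    refine (hC _ z₀ δ _ hδ (memLp_vecMul hB v k).1 (support_vecMul_subset hBs v k)
      (eLpNorm_vecMul_le (one_le_two.trans hp.le) (fun j k => (hB j k).1) hBM v k) z).trans_eq ?_
    push_cast
    ring
  let L (v : ℂ →ᵇ ι → ℂ) : ℂ →ᵇ ι → ℂ :=
    .ofNormedAddCommGroup (fun z k => cauchyTransform (fun w => (v w ᵥ* B w) k) z)
      (continuous_pi (hcont v)) _ (hbound v)
  have hL_sub : ∀ v v', L (v - v') = L v - L v' := fun v v' => by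
    ext z k
    have hdensity : (fun w => ((v - v') w ᵥ* B w) k) =
        (fun w => (v w ᵥ* B w) k) - fun w => (v' w ᵥ* B w) k := by
      ext w
      rw [BoundedContinuousFunction.sub_apply, Matrix.sub_vecMul, Pi.sub_apply, Pi.sub_apply]
    exact (congrArg (cauchyTransform · z) hdensity).trans
      (cauchyTransform_sub hp (memLp_vecMul hB v k) (memLp_vecMul hB v' k) hδ
        (support_vecMul_subset hBs v k) (support_vecMul_subset hBs v' k) z)
  refine ⟨AddMonoidHom.ofMapSub L hL_sub, fun v z k => rfl, fun v => ?_⟩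
  exact norm_ofNormedAddCommGroup_le _ (by positivity) (hbound v)

variable [DecidableEq ι] {g : ℂ → Matrix ι ι ℂ}

/-- `g` solves `g = T ((1 + g) B)` with `T` the Cauchy transform, the integral form of
`∂(1 + g)/∂z̄ = (1 + g) B`, with densities in `L^p`. For `B = -A` the frame `1 + g` removes the
coefficient `A` from `∂f/∂z̄ = A f`. -/
structure IsGauge (p : ℝ≥0∞) (B g : ℂ → Matrix ι ι ℂ) : Prop where
  memLp (j k : ι) : MemLp (fun w => ((1 + g w) * B w) j k) p
  eq_cauchyTransform (z : ℂ) (j k : ι) :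
    g z j k = cauchyTransform (fun w => ((1 + g w) * B w) j k) z

lemma isUnit_one_add_of_norm_le {g : Matrix ι ι ℂ} {η : ℝ} (hg : ∀ j k, ‖g j k‖ ≤ η)
    (hη : Fintype.card ι * η < 1) : IsUnit (1 + g) := by
  rw [Matrix.isUnit_iff_isUnit_det, isUnit_iff_ne_zero]
  refine det_ne_zero_of_sum_row_lt_diag fun k => ?_
  have hoffdiag : ∑ j ∈ Finset.univ.erase k, ‖(1 + g) k j‖ =
      ∑ j ∈ Finset.univ.erase k, ‖g k j‖ := by
    refine Finset.sum_congr rfl fun j hj => ?_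
    rw [Matrix.add_apply, Matrix.one_apply_ne (Finset.ne_of_mem_erase hj).symm, zero_add]
  have hdiag : 1 - ‖g k k‖ ≤ ‖(1 + g) k k‖ := by
    rw [Matrix.add_apply, Matrix.one_apply_eq]
    simpa using norm_sub_norm_le (1 : ℂ) (-g k k)
  have hrow : ∑ j, ‖g k j‖ ≤ Fintype.card ι * η :=
    (Finset.sum_le_sum fun j _ => hg k j).trans_eq (by simp)
  have hsplit := Finset.sum_erase_add _ (fun j => ‖g k j‖) (Finset.mem_univ k)
  rw [hoffdiag]
  linarith

theorem exists_isGauge (ι : Type*) [Fintype ι] [DecidableEq ι] (hp : 2 < p) :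
    ∃ ε c : ℝ, 0 < ε ∧ 0 < c ∧ ∀ (z₀ : ℂ) (δ : ℝ) (M : ℝ≥0) (B : ℂ → Matrix ι ι ℂ), 0 < δ →
      (∀ j k, MemLp (fun w => B w j k) p) → (∀ j k, eLpNorm (fun w => B w j k) p ≤ M) →
      Function.support B ⊆ Metric.ball z₀ δ → M * δ ^ (1 - 2 / p.toReal) < ε →
      ∃ g, IsGauge p B g ∧ (∀ w, IsUnit (1 + g w)) ∧
        ∀ w j k, ‖g w j k‖ ≤ c * (M * δ ^ (1 - 2 / p.toReal)) := by
  obtain ⟨C, hC⟩ := exists_addMonoidHom_cauchyTransform_vecMul ι hp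
  refine ⟨1 / (2 * (C + 1) * (Fintype.card ι + 1)), 2 * (C + 1), by positivity, by positivity,
    fun z₀ δ M B hδ hB hBM hBs hsmall => ?_⟩
  obtain ⟨L, hL, hLle⟩ := hC B z₀ δ M hδ hB hBM hBs
  set s := M * δ ^ (1 - 2 / p.toReal)
  have hs : 0 ≤ s := by positivity
  have hκs : 2 * (C + 1) * s * (Fintype.card ι + 1) < 1 := by
    rw [lt_div_iff₀ (by positivity)] at hsmall
    linarith
  have hκ : (C * s : ℝ) ∈ Icc 0 (1 / 2) := by
    have : 0 ≤ (C + 1) * s * Fintype.card ι := by positivity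
    exact ⟨by positivity, by nlinarith⟩
  choose v hv hvle using fun j => exists_map_add_eq_self L hκ hLle
    (BoundedContinuousFunction.const ℂ ((1 : Matrix ι ι ℂ) j))
  let G j : BoundedContinuousFunction ℂ (ι → ℂ) := .const ℂ ((1 : Matrix ι ι ℂ) j) + v j
  have hgle : ∀ w j k, ‖v j w k‖ ≤ 2 * (C + 1) * s := fun w j k => by
    have hone : ‖BoundedContinuousFunction.const ℂ ((1 : Matrix ι ι ℂ) j)‖ ≤ 1 :=
      (BoundedContinuousFunction.norm_const_le _).trans
        ((pi_norm_le_iff_of_nonneg zero_le_one).2 fun k => by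
          by_cases h : j = k <;> simp [Matrix.one_apply, h])
    have := (norm_apply_le_norm (v j) w k).trans (hvle j)
    nlinarith [mul_le_mul_of_nonneg_left hone (mul_nonneg zero_le_two hκ.1)]
  refine ⟨fun w => Matrix.of fun j => v j w, ⟨fun j k => memLp_vecMul hB (G j) k, fun z j k => ?_⟩,
    fun w => isUnit_one_add_of_norm_le (hgle w) (by nlinarith), hgle⟩
  have hfix : L (G j) z k = v j z k := by rw [show L (G j) = v j from hv j]
  exact hfix.symm.trans (hL (G j) z k)

namespace IsGauge

lemma support_subset (hBs : Function.support B ⊆ Metric.ball z₀ δ) (j k : ι) :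
    Function.support (fun w => ((1 + g w) * B w) j k) ⊆ Metric.ball z₀ δ :=
  support_vecMul_subset hBs (fun w => (1 + g w) j) k

lemma exists_holderWith (hg : IsGauge p B g) {q : ℝ≥0∞} (hq : 2 < q) (hqt : q ≠ ⊤) (hqp : q ≤ p)
    (hδ : 0 < δ) (hBs : Function.support B ⊆ Metric.ball z₀ δ) (j k : ι) :
    ∃ C : ℝ≥0, HolderWith C (1 - 2 / q.toReal).toNNReal fun w => g w j k := by
  simp only [hg.eq_cauchyTransform _ j k]
  exact exists_holderWith_cauchyTransform hq hqt
    (memLp_of_le_of_support_subset_ball (hg.memLp j k) hqp (support_subset hBs j k)) hδ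
    (support_subset hBs j k)

lemma continuous (hg : IsGauge p B g) (hp : 2 < p) (hδ : 0 < δ)
    (hBs : Function.support B ⊆ Metric.ball z₀ δ) : Continuous g := by
  refine continuous_matrix fun j k => ?_
  simp only [hg.eq_cauchyTransform _ j k]
  exact continuous_cauchyTransform hp (hg.memLp j k) hδ (support_subset hBs j k)

variable {f : ℂ → ι → ℂ} {A : ℂ → Matrix ι ι ℂ} {U : Set ℂ}

lemma weakDbarOn_mulVec (hg : IsGauge p B g) (hp : 2 < p) (hδ : 0 < δ)
    (hBs : Function.support B ⊆ Metric.ball z₀ δ) (hU : IsOpen U) (hf : ContinuousOn f U)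
    (H : ∀ j, WeakDbarOn (fun z => f z j) (fun z => (A z *ᵥ f z) j) U) (hBA : EqOn B (-A) U)
    (j : ι) : WeakDbarOn (fun z => ((1 + g z) *ᵥ f z) j) 0 U := by
  have hprod := (H j).add (WeakDbarOn.sum fun k (_ : k ∈ Finset.univ) =>
    (H k).mul_cauchyTransform hU ((continuous_apply k).comp_continuousOn hf) hp (hg.memLp j k) hδ
      (support_subset hBs j k))
  refine hprod.congr hU.measurableSet (fun z _ => ?_) fun z hz => ?_
  · rw [Matrix.add_mulVec, Matrix.one_mulVec, Pi.add_apply]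
    simp only [← hg.eq_cauchyTransform, Matrix.mulVec, dotProduct, mul_comm]
  · have hcancel : A z *ᵥ f z + (g z *ᵥ (A z *ᵥ f z) + ((1 + g z) * B z) *ᵥ f z) = 0 := by
      rw [hBA hz, Pi.neg_apply, mul_neg, Matrix.neg_mulVec, add_mul, one_mul, Matrix.add_mulVec,
        Matrix.mulVec_mulVec]
      abel
    simpa only [← hg.eq_cauchyTransform, Finset.sum_add_distrib, mul_comm, Pi.add_apply,
      Pi.zero_apply, Matrix.mulVec, dotProduct] using congrFun hcancel j

lemma differentiableOn_mulVec (hg : IsGauge p B g) (hp : 2 < p) (hδ : 0 < δ)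
    (hBs : Function.support B ⊆ Metric.ball z₀ δ) (hU : IsOpen U) (hf : ContinuousOn f U)
    (H : ∀ j, WeakDbarOn (fun z => f z j) (fun z => (A z *ᵥ f z) j) (U ∩ {z | f z ≠ 0}))
    (hBA : EqOn B (-A) (U ∩ {z | f z ≠ 0})) :
    DifferentiableOn ℂ (fun z => (1 + g z) *ᵥ f z) U := by
  have hopen : IsOpen (U ∩ {z | f z ≠ 0}) := hf.isOpen_inter_preimage hU isOpen_compl_singleton
  refine differentiableOn_pi.2 fun j => ?_
  have hentry : ∀ k, Continuous fun z => (1 + g z) j k := fun k =>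
    (continuous_const.add (hg.continuous hp hδ hBs)).matrix_elem j k
  have hcont : ContinuousOn (fun z => ((1 + g z) *ᵥ f z) j) U :=
    continuousOn_finsetSum _ fun k _ =>
      (hentry k).continuousOn.mul ((continuous_apply k).comp_continuousOn hf)
  have hdiff := (hg.weakDbarOn_mulVec hp hδ hBs hopen (hf.mono inter_subset_left) H hBA
    j).differentiableOn hopen (hcont.mono inter_subset_left)
  refine differentiableOn_of_differentiableOn_ne_zero hU hcont (hdiff.mono ?_)
  exact inter_subset_inter_right U fun z hz hfz => hz (by simp [hfz])

end IsGauge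

end Gauge

section LocalGauge

variable {m : ℕ} {p : ℝ≥0∞} {Ω : Set ℂ} {f : ℂ → Fin m → ℂ}

lemma isOpen_offZeros (hΩ : IsOpen Ω) (hf : ContinuousOn f Ω) : IsOpen (offZeros Ω f) :=
  hf.isOpen_inter_preimage hΩ isOpen_compl_singleton

lemma indicator_apply_apply {ι : Type*} (S : Set ℂ) (A : ℂ → Matrix ι ι ℂ) (j k : ι) :
    (fun w => S.indicator A w j k) = S.indicator fun w => A w j k := by
  ext w
  by_cases hw : w ∈ S <;> simp [hw]

/-- The frame `1 + g` is invertible and `(1 + g) f` is holomorphic on `U`, with the entries of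
`g` bounded by `K` and Hölder continuous of exponent `1 - 2/q` for all finite `q ∈ (2, p]`. -/
structure IsHolomorphicFrame (p : ℝ≥0∞) (f : ℂ → Fin m → ℂ) (U : Set ℂ) (K : ℝ)
    (g : ℂ → Matrix (Fin m) (Fin m) ℂ) : Prop where
  isUnit (w : ℂ) : IsUnit (1 + g w)
  differentiableOn : DifferentiableOn ℂ (fun w => (1 + g w) *ᵥ f w) U
  exists_holderWith {q : ℝ≥0∞} (hq : 2 < q) (hqt : q ≠ ⊤) (hqp : q ≤ p) (j k : Fin m) :
    ∃ C : ℝ≥0, HolderWith C (1 - 2 / q.toReal).toNNReal fun w => g w j k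
  norm_le (w : ℂ) (j k : Fin m) : ‖g w j k‖ ≤ K

theorem exists_isHolomorphicFrame (m : ℕ) (hp : 2 < p) :
    ∃ ε c : ℝ, 0 < ε ∧ 0 < c ∧
      ∀ (Ω : Set ℂ) (f : ℂ → Fin m → ℂ) (A : ℂ → Matrix (Fin m) (Fin m) ℂ) (M : ℝ≥0),
      IsOpen Ω → ContinuousOn f Ω →
      (∀ j k, MemLp (fun z => A z j k) p (volume.restrict (offZeros Ω f))) →
      (∀ j k, eLpNorm (fun z => A z j k) p (volume.restrict (offZeros Ω f)) ≤ M) →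
      DbarEqOn f (fun z => A z *ᵥ f z) (offZeros Ω f) →
      ∀ (z : ℂ) (δ : ℝ), 0 < δ → M * δ ^ (1 - 2 / p.toReal) < ε →
        ∃ g, IsHolomorphicFrame p f (Metric.ball z δ ∩ Ω) (c * (M * δ ^ (1 - 2 / p.toReal))) g := by
  obtain ⟨ε, c, hε, hc, H⟩ := exists_isGauge (Fin m) hp
  refine ⟨ε, c, hε, hc, fun Ω f A M hΩ hf hA hAM hdbar z δ hδ hsmall => ?_⟩
  set S := offZeros Ω f ∩ Metric.ball z δ
  have hSm : MeasurableSet S :=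
    ((isOpen_offZeros hΩ hf).inter Metric.isOpen_ball).measurableSet
  have hrestrict : (volume : Measure ℂ).restrict S ≤ volume.restrict (offZeros Ω f) :=
    Measure.restrict_mono_set _ inter_subset_left
  have hB : ∀ j k, MemLp (fun w => S.indicator (-A) w j k) p := fun j k => by
    rw [indicator_apply_apply, memLp_indicator_iff_restrict hSm]
    exact ((hA j k).mono_measure hrestrict).neg
  have hBM : ∀ j k, eLpNorm (fun w => S.indicator (-A) w j k) p ≤ M := fun j k => by
    rw [indicator_apply_apply, eLpNorm_indicator_eq_eLpNorm_restrict hSm]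
    exact (eLpNorm_neg (fun w => A w j k) p _).trans_le
      ((eLpNorm_mono_measure _ hrestrict).trans (hAM j k))
  have hBs : Function.support (S.indicator (-A)) ⊆ Metric.ball z δ :=
    support_indicator_subset.trans inter_subset_right
  obtain ⟨g, hg, hunit, hgle⟩ := H z δ M (S.indicator (-A)) hδ hB hBM hBs hsmall
  have hsub : Metric.ball z δ ∩ Ω ∩ {w | f w ≠ 0} ⊆ S := fun w hw => ⟨⟨hw.1.2, hw.2⟩, hw.1.1⟩
  have hweak := dbarEqOn_iff_forall_weakDbarOn.1 hdbar
  refine ⟨g, hunit, ?_, fun hq hqt hqp => hg.exists_holderWith hq hqt hqp hδ hBs, hgle⟩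
  exact hg.differentiableOn_mulVec hp hδ hBs (Metric.isOpen_ball.inter hΩ)
    (hf.mono inter_subset_right) (fun j => (hweak j).mono (hsub.trans inter_subset_left))
    fun w hw => indicator_of_mem (hsub hw) (-A)

end LocalGauge

section Zeros

variable {m : ℕ} {p : ℝ≥0∞} {Ω : Set ℂ} {f : ℂ → Fin m → ℂ} {A : ℂ → Matrix (Fin m) (Fin m) ℂ}

lemma IsHolomorphicFrame.eventually_eq_zero_or_eventually_ne_zero {U : Set ℂ} {K : ℝ}
    {g : ℂ → Matrix (Fin m) (Fin m) ℂ} (hg : IsHolomorphicFrame p f U K g) (hU : IsOpen U) {z : ℂ}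
    (hz : z ∈ U) : (∀ᶠ w in 𝓝 z, f w = 0) ∨ ∀ᶠ w in 𝓝[≠] z, f w ≠ 0 := by
  have hanalytic : ∀ j, AnalyticAt ℂ (fun w => ((1 + g w) *ᵥ f w) j) z := fun j =>
    (differentiableOn_pi.1 hg.differentiableOn j).analyticAt (hU.mem_nhds hz)
  by_cases hzero : ∀ j, ∀ᶠ w in 𝓝 z, ((1 + g w) *ᵥ f w) j = 0
  · left
    filter_upwards [eventually_all.2 hzero] with w hw
    refine Matrix.mulVec_injective_of_isUnit (hg.isUnit w) ?_
    rw [Matrix.mulVec_zero]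
    exact funext hw
  · right
    obtain ⟨j, hj⟩ := not_forall.1 hzero
    filter_upwards [(hanalytic j).eventually_eq_zero_or_eventually_ne_zero.resolve_left hj]
      with w hw hfw
    exact hw (by simp [hfw])

lemma eventually_eq_zero_of_isPreconnected {E : Type*} [Zero E] {f : ℂ → E}
    (hΩ : IsPreconnected Ω)
    (h : ∀ z ∈ Ω, (∀ᶠ w in 𝓝 z, f w = 0) ∨ ∀ᶠ w in 𝓝[≠] z, f w ≠ 0) {z₀ : ℂ} (hz₀ : z₀ ∈ Ω)
    (hfz₀ : ∀ᶠ w in 𝓝 z₀, f w = 0) : ∀ z ∈ Ω, ∀ᶠ w in 𝓝 z, f w = 0 := by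
  have hopen : IsOpen {z | ∀ᶠ w in 𝓝 z, f w = 0} := isOpen_setOfPred_eventually_nhds
  refine hΩ.subset_of_closure_inter_subset hopen ⟨z₀, hz₀, hfz₀⟩ ?_
  rintro x ⟨hx, hxΩ⟩
  rcases h x hxΩ with hzero | hne
  · exact hzero
  · obtain ⟨y, hy, hyS⟩ := mem_closure_iff_nhds.1 hx _ (eventually_nhdsWithin_iff.1 hne)
    have hyzero : ∀ᶠ w in 𝓝 y, f w = 0 := hyS
    rcases eq_or_ne y x with rfl | hyx
    · exact hyzero
    · exact absurd hyzero.self_of_nhds (hy hyx)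

lemma exists_eLpNorm_le_of_memLp {ι : Type*} [Finite ι] {μ : Measure ℂ} {A : ℂ → Matrix ι ι ℂ}
    (hA : ∀ j k, MemLp (fun z => A z j k) p μ) :
    ∃ M : ℝ≥0, ∀ j k, eLpNorm (fun z => A z j k) p μ ≤ M := by
  obtain ⟨M, hM⟩ := Finite.bddAbove_range fun jk : ι × ι =>
    (eLpNorm (fun z => A z jk.1 jk.2) p μ).toNNReal
  refine ⟨M, fun j k => ?_⟩
  have hle : (eLpNorm (fun z => A z j k) p μ).toNNReal ≤ M := hM (mem_range_self (j, k))
  rwa [← ENNReal.coe_le_coe, ENNReal.coe_toNNReal (hA j k).2.ne] at hle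

lemma exists_pos_mul_rpow_lt (hp : 2 < p) (M : ℝ≥0) {ε : ℝ} (hε : 0 < ε) :
    ∃ δ : ℝ, 0 < δ ∧ M * δ ^ (1 - 2 / p.toReal) < ε := by
  have hexp := one_sub_two_div_toReal_pos hp
  have hlim : Tendsto (fun δ : ℝ => M * δ ^ (1 - 2 / p.toReal)) (𝓝[>] 0) (𝓝 0) := by
    have := ((Real.continuousAt_rpow_const 0 (1 - 2 / p.toReal) (Or.inr hexp.le)).tendsto.const_mul
      (M : ℝ)).mono_left (nhdsWithin_le_nhds (s := Ioi 0))
    rwa [Real.zero_rpow hexp.ne', mul_zero] at this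
  exact (eventually_mem_nhdsWithin.and (hlim.eventually_lt_const hε)).exists

lemma eventually_eq_zero_or_eventually_ne_zero_of_dbarEqOn (hp : 2 < p) (hΩ : IsOpen Ω)
    (hf : ContinuousOn f Ω)
    (hA : ∀ j k, MemLp (fun z => A z j k) p (volume.restrict (offZeros Ω f)))
    (hdbar : DbarEqOn f (fun z => A z *ᵥ f z) (offZeros Ω f)) :
    ∀ z ∈ Ω, (∀ᶠ w in 𝓝 z, f w = 0) ∨ ∀ᶠ w in 𝓝[≠] z, f w ≠ 0 := by
  intro z hz
  obtain ⟨ε, c, hε, -, H⟩ := exists_isHolomorphicFrame m hp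
  obtain ⟨M, hM⟩ := exists_eLpNorm_le_of_memLp hA
  obtain ⟨δ, hδ, hδε⟩ := exists_pos_mul_rpow_lt hp M hε
  obtain ⟨g, hg⟩ := H Ω f A M hΩ hf hA hM hdbar z δ hδ hδε
  exact hg.eventually_eq_zero_or_eventually_ne_zero (Metric.isOpen_ball.inter hΩ)
    ⟨Metric.mem_ball_self hδ, hz⟩

theorem eventually_ne_zero_of_dbarEqOn (hp : 2 < p) (hΩ : IsOpen Ω) (hΩc : IsPreconnected Ω)
    (hf : ContinuousOn f Ω)
    (hA : ∀ j k, MemLp (fun z => A z j k) p (volume.restrict (offZeros Ω f)))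
    (hdbar : DbarEqOn f (fun z => A z *ᵥ f z) (offZeros Ω f)) (hne : ∃ z ∈ Ω, f z ≠ 0) :
    ∀ z ∈ Ω, ∀ᶠ w in 𝓝[≠] z, f w ≠ 0 := by
  have hdich := eventually_eq_zero_or_eventually_ne_zero_of_dbarEqOn hp hΩ hf hA hdbar
  obtain ⟨a, ha, hfa⟩ := hne
  refine fun z hz => (hdich z hz).resolve_left fun hzero => hfa ?_
  exact (eventually_eq_zero_of_isPreconnected hΩc hdich hz hzero a ha).self_of_nhds

end Zeros

section Extension

variable {m : ℕ} {p : ℝ≥0∞} {Ω : Set ℂ} {f : ℂ → Fin m → ℂ} {A : ℂ → Matrix (Fin m) (Fin m) ℂ}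

lemma locallyIntegrableOn_mulVec {ι : Type*} [Fintype ι] {f : ℂ → ι → ℂ} {A : ℂ → Matrix ι ι ℂ}
    (hp : 1 ≤ p) (hΩ : IsOpen Ω) (hf : ContinuousOn f Ω)
    (hA : ∀ j k, MemLp (fun z => A z j k) p) (j : ι) :
    LocallyIntegrableOn (fun z => (A z *ᵥ f z) j) Ω :=
  locallyIntegrableOn_finsetSum fun k _ =>
    (((hA j k).locallyIntegrable hp).locallyIntegrableOn Ω).mul_continuousOn
      ((continuous_apply k).comp_continuousOn hf) hΩ.isLocallyClosed

theorem dbarEqOn_indicator (hp : 2 < p) (hΩ : IsOpen Ω) (hf : ContinuousOn f Ω)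
    (hA : ∀ j k, MemLp (fun z => A z j k) p (volume.restrict (offZeros Ω f)))
    (hdbar : DbarEqOn f (fun z => A z *ᵥ f z) (offZeros Ω f)) :
    DbarEqOn f (fun z => (offZeros Ω f).indicator A z *ᵥ f z) Ω := by
  have hoff := isOpen_offZeros hΩ hf
  have hind : ∀ j k, MemLp (fun z => (offZeros Ω f).indicator A z j k) p := fun j k => by
    rw [indicator_apply_apply, memLp_indicator_iff_restrict hoff.measurableSet]
    exact hA j k
  refine dbarEqOn_iff_forall_weakDbarOn.2 fun j => .of_forall_exists fun z hz => ?_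
  have hloc := locallyIntegrableOn_mulVec (one_le_two.trans hp.le) hΩ hf hind j
  rcases eventually_eq_zero_or_eventually_ne_zero_of_dbarEqOn hp hΩ hf hA hdbar z hz with
    hzero | hne
  · obtain ⟨V, hV, hVo, hzV⟩ := eventually_nhds_iff.1 hzero
    refine ⟨V, hVo, hzV, (WeakDbarOn.zero V).congr hVo.measurableSet ?_ ?_⟩ <;>
      exact fun w hw => by simp [hV w hw]
  · obtain ⟨V, hV, hVo, hzV⟩ := eventually_nhds_iff.1 (eventually_nhdsWithin_iff.1 hne)
    have hsub : (V ∩ Ω) \ {z} ⊆ offZeros Ω f := fun w hw => ⟨hw.1.2, hV w hw.1.1 hw.2⟩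
    have hoffeq : WeakDbarOn (fun w => f w j)
        (fun w => ((offZeros Ω f).indicator A w *ᵥ f w) j) (offZeros Ω f) :=
      (dbarEqOn_iff_forall_weakDbarOn.1 hdbar j).congr hoff.measurableSet (fun _ _ => rfl)
        fun w hw => by simp only [indicator_of_mem hw]
    exact ⟨V ∩ Ω, hVo.inter hΩ, ⟨hzV, hz⟩, (hoffeq.mono hsub).of_diff_singleton (hVo.inter hΩ)
      (((continuous_apply j).comp_continuousOn hf).mono inter_subset_right)
      (hloc.mono_set inter_subset_right)⟩

end Extension

section Main

variable {m : ℕ} {p : ℝ≥0∞}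

lemma rpow_le_phi {δ : ℝ} (hδ : 0 < δ) : δ ^ (1 - 2 / p.toReal) ≤ phi p δ := by
  rw [phi]
  split_ifs with h
  · simp only [h, ENNReal.toReal_top, div_zero, sub_zero, Real.rpow_one]
    nlinarith [abs_nonneg (Real.log δ)]
  · exact le_rfl

namespace IsHolomorphicFrame

variable {f : ℂ → Fin m → ℂ} {U : Set ℂ} {K : ℝ} {g : ℂ → Matrix (Fin m) (Fin m) ℂ}

lemma matrixHolderOn (hg : IsHolomorphicFrame p f U K g) {q : ℝ≥0∞} (hq : 2 < q) (hqt : q ≠ ⊤)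
    (hqp : q ≤ p) (V : Set ℂ) : MatrixHolderOn (1 - 2 / q.toReal).toNNReal g V := fun j k =>
  (hg.exists_holderWith hq hqt hqp j k).imp fun _ hC => hC.holderOnWith V

lemma matrixHolderOn_of_lt_one (hg : IsHolomorphicFrame ⊤ f U K g) {α : ℝ≥0} (hα : 0 < α)
    (hα' : α < 1) (V : Set ℂ) : MatrixHolderOn α g V := by
  have hpos : (0 : ℝ) < 1 - α := sub_pos.2 (by exact_mod_cast hα')
  have hq : (2 : ℝ) < 2 / (1 - α) := by
    rw [lt_div_iff₀ hpos]
    linarith [NNReal.coe_pos.2 hα]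
  have hexp : (1 - 2 / (ENNReal.ofReal (2 / (1 - α))).toReal).toNNReal = α := by
    rw [ENNReal.toReal_ofReal (by linarith), div_div_cancel₀ two_ne_zero, sub_sub_cancel,
      Real.toNNReal_coe]
  have hq' : 2 < ENNReal.ofReal (2 / (1 - α)) := by
    simpa using (ENNReal.ofReal_lt_ofReal_iff (by linarith)).2 hq
  exact hexp ▸ hg.matrixHolderOn hq' ENNReal.ofReal_ne_top le_top V

end IsHolomorphicFrame

theorem propositionC_general (m : ℕ) (p : ℝ≥0∞) (hp : 2 < p) :
    (∀ (Ω : Set ℂ) (f : ℂ → Fin m → ℂ) (A : ℂ → Matrix (Fin m) (Fin m) ℂ),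
      IsOpen Ω → ContinuousOn f Ω →
      (∀ j k, MemLp (fun z => A z j k) p (volume.restrict (offZeros Ω f))) →
      DbarEqOn f (fun z => A z *ᵥ f z) (offZeros Ω f) →
        (IsPreconnected Ω → (∃ z ∈ Ω, f z ≠ 0) → ∀ z ∈ Ω, ∀ᶠ w in 𝓝[≠] z, f w ≠ 0) ∧
        DbarEqOn f (fun z => (offZeros Ω f).indicator A z *ᵥ f z) Ω) ∧
    (∃ ε c : ℝ, 0 < ε ∧ 0 < c ∧
      ∀ (Ω : Set ℂ) (f : ℂ → Fin m → ℂ) (A : ℂ → Matrix (Fin m) (Fin m) ℂ) (M : ℝ≥0),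
      IsOpen Ω → ContinuousOn f Ω →
      (∀ j k, MemLp (fun z => A z j k) p (volume.restrict (offZeros Ω f))) →
      (∀ j k, eLpNorm (fun z => A z j k) p (volume.restrict (offZeros Ω f)) ≤ M) →
      DbarEqOn f (fun z => A z *ᵥ f z) (offZeros Ω f) →
        ∀ δ : ℝ, 0 < δ → M * phi p δ < ε → ∀ z : ℂ,
          ∃ g : ℂ → Matrix (Fin m) (Fin m) ℂ,
            (∀ w ∈ Metric.ball z δ, IsUnit (1 + g w)) ∧
            DifferentiableOn ℂ (fun w => (1 + g w) *ᵥ f w) (Metric.ball z δ ∩ Ω) ∧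
            (p ≠ ⊤ → MatrixHolderOn (1 - 2 / p.toReal).toNNReal g (Metric.ball z δ)) ∧
            (p = ⊤ → ∀ α : ℝ≥0, 0 < α → α < 1 → MatrixHolderOn α g (Metric.ball z δ)) ∧
            (∀ w ∈ Metric.ball z δ, ∀ j k, ‖g w j k‖ ≤ c * M * phi p δ)) := by
  refine ⟨fun Ω f A hΩ hf hA hdbar => ⟨fun hΩc hne =>
    eventually_ne_zero_of_dbarEqOn hp hΩ hΩc hf hA hdbar hne,
    dbarEqOn_indicator hp hΩ hf hA hdbar⟩, ?_⟩
  obtain ⟨ε, c, hε, hc, H⟩ := exists_isHolomorphicFrame m hp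
  refine ⟨ε, c, hε, hc, fun Ω f A M hΩ hf hA hAM hdbar δ hδ hsmall z => ?_⟩
  have hle : M * δ ^ (1 - 2 / p.toReal) ≤ M * phi p δ :=
    mul_le_mul_of_nonneg_left (rpow_le_phi hδ) M.2
  obtain ⟨g, hg⟩ := H Ω f A M hΩ hf hA hAM hdbar z δ hδ (hle.trans_lt hsmall)
  refine ⟨g, fun w _ => hg.isUnit w, hg.differentiableOn,
    fun hpt => hg.matrixHolderOn hp hpt le_rfl _, ?_, fun w _ j k => (hg.norm_le w j k).trans ?_⟩
  · rintro rfl α hα hα'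
    exact hg.matrixHolderOn_of_lt_one hα hα' _
  · rw [mul_assoc]
    exact mul_le_mul_of_nonneg_left hle hc.le

end Main

theorem propositionC (m : ℕ) (p : ℝ≥0∞) (hp : 2 < p) :
    (∀ (Ω : Set ℂ) (f : ℂ → Fin m → ℂ) (A : ℂ → Matrix (Fin m) (Fin m) ℂ),
      IsOpen Ω → IsConnected Ω → ContinuousOn f Ω →
      (∀ j k, MemLp (fun z => A z j k) p (volume.restrict (offZeros Ω f))) →
      DbarEqOn f (fun z => A z *ᵥ f z) (offZeros Ω f) →
      (∃ z ∈ Ω, f z ≠ 0) →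
        (∀ z ∈ Ω, f z = 0 → ∀ᶠ w in 𝓝[≠] z, f w ≠ 0) ∧
        DbarEqOn f (fun z => (offZeros Ω f).indicator A z *ᵥ f z) Ω) ∧
    (∃ ε c : ℝ, 0 < ε ∧ 0 < c ∧
      ∀ (Ω : Set ℂ) (f : ℂ → Fin m → ℂ) (A : ℂ → Matrix (Fin m) (Fin m) ℂ) (M : ℝ≥0),
      IsOpen Ω → IsConnected Ω → ContinuousOn f Ω →
      (∀ j k, MemLp (fun z => A z j k) p (volume.restrict (offZeros Ω f))) →
      (∀ j k, eLpNorm (fun z => A z j k) p (volume.restrict (offZeros Ω f)) ≤ M) →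
      DbarEqOn f (fun z => A z *ᵥ f z) (offZeros Ω f) →
        (∀ δ : ℝ, 0 < δ → M * phi p δ < ε → ∀ z ∈ Ω,
          ∃ g : ℂ → Matrix (Fin m) (Fin m) ℂ,
            (∀ w ∈ Metric.ball z δ, IsUnit (1 + g w)) ∧
            DifferentiableOn ℂ (fun w => (1 + g w) *ᵥ f w) (Metric.ball z δ ∩ Ω) ∧
            (p ≠ ⊤ → MatrixHolderOn (1 - 2 / p.toReal).toNNReal g (Metric.ball z δ)) ∧
            (p = ⊤ → ∀ α : ℝ≥0, 0 < α → α < 1 → MatrixHolderOn α g (Metric.ball z δ)) ∧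
            (∀ w ∈ Metric.ball z δ, ∀ j k, ‖g w j k‖ ≤ c * M * phi p δ)) ∧
        DbarEqOn f (fun z => (offZeros Ω f).indicator A z *ᵥ f z) Ω) := by
  obtain ⟨hext, ε, c, hε, hc, hframe⟩ := propositionC_general m p hp
  refine ⟨fun Ω f A hΩ hΩc hf hA hdbar hne => ?_, ε, c, hε, hc, fun Ω f A M hΩ _ hf hA hAM hdbar =>
    ⟨fun δ hδ hsmall z _ => hframe Ω f A M hΩ hf hA hAM hdbar δ hδ hsmall z,
      (hext Ω f A hΩ hf hA hdbar).2⟩⟩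
  obtain ⟨hiso, heq⟩ := hext Ω f A hΩ hf hA hdbar
  exact ⟨fun z hz _ => hiso hΩc.isPreconnected hne z hz, heq⟩
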